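/- Let $k,n\ge 1$ be integers and let $A$ be the Razak block $$A=\{f\in C([0,1],M_k\otimes M_n)\;:\; f(0)=c\otimes 1_{n-1},\ f(1)=c\otimes 1_n \text{ for some } c\in M_k\},$$ where $M_k=M_k(\mathbb C)$, $1_n$ is the unit of $M_n$ and $1_{n-1}=\mathrm{diag}(1,\dots,1,0)\in M_n$; $A$ is a $\mathrm{C}^*$-subalgebra of $C([0,1],M_k\otimes M_n)$. Let $\tilde A$ be the minimal unitisation of $A$, $\mathcal U(\tilde A)$ its unitary group, and $\mathcal K$ the algebra of compact operators on $\ell^2(\mathbb N)$. For a positive $x\in A$ and $s\ge 0$ let $e_s(x)=(x-s)_+$ be the element obtained from $x$ by functional calculus with the function $t\mapsto\max\{0,t-s\}$. For positive $x,y\in A$ write $x\precsim y$ (Cuntz subequivalence) if there are $v_m\in A\otimes\mathcal K$ with $\|x-v_m y v_m^*\|\to 0$, where $A$ is identified with the corner $A\otimes e_{11}$ of $A\otimes\mathcal K$. For positive $a,b\in A$ define $$d_U(a,b)=\inf\{\|uau^*-b\| : u\in\mathcal U(\tilde A)\},$$ $$d_W(a,b)=\inf\{r>0 : e_{t+r}(a)\precsim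 e_t(b)\ \text{and}\ e_{t+r}(b)\precsim e_t(a)\ \text{for all } t>0\}.$$ Then $d_U(a,b)=d_W(a,b)$ for all positive $a,b\in A$. -/

import Mathlib

open Filter Topology

noncomputable section

section RazakBlocks

open scoped Kronecker Matrix.Norms.L2Operator unitInterval

/-- The projection `1_{n-1} = diag(1, …, 1, 0)` in `M_n(ℂ)`. -/
def cornerOne (n : ℕ) : Matrix (Fin n) (Fin n) ℂ :=
  Matrix.diagonal fun i => if (i : ℕ) + 1 < n then 1 else 0

lemma cornerOne_mul_self (n : ℕ) : cornerOne n * cornerOne n = cornerOne n := by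
  simp [cornerOne, Matrix.diagonal_mul_diagonal]

lemma conjTranspose_cornerOne (n : ℕ) : (cornerOne n).conjTranspose = cornerOne n := by
  rw [cornerOne, Matrix.diagonal_conjTranspose]
  congr 1
  ext i
  by_cases h : (i : ℕ) + 1 < n <;> simp [h]

/-- The linear map `c ↦ (c ⊗ 1_{n-1}, c ⊗ 1_n)`, which describes the boundary values of the
elements of a Razak block. The algebra `M_k ⊗ M_n` is realised as the algebra of complex matrices
indexed by `Fin k × Fin n` by means of the Kronecker product, with the `C⋆`-norm (the operator
norm on `ℂ^k ⊗ ℂ^n`). -/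
def razakBoundary (k n : ℕ) : Matrix (Fin k) (Fin k) ℂ →ₗ[ℂ]
    Matrix (Fin k × Fin n) (Fin k × Fin n) ℂ × Matrix (Fin k × Fin n) (Fin k × Fin n) ℂ where
  toFun c := (c ⊗ₖ cornerOne n, c ⊗ₖ (1 : Matrix (Fin n) (Fin n) ℂ))
  map_add' c d := by simp [Matrix.add_kronecker]
  map_smul' z c := by simp [Matrix.smul_kronecker]

/-- The Razak block
`{f ∈ C([0,1], M_k ⊗ M_n) | f(0) = c ⊗ 1_{n-1}, f(1) = c ⊗ 1_n for some c ∈ M_k}`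
as a `⋆`-subalgebra of `C([0,1], M_k ⊗ M_n)`. -/
def razakSubalgebra (k n : ℕ) :
    NonUnitalStarSubalgebra ℂ C(I, Matrix (Fin k × Fin n) (Fin k × Fin n) ℂ) where
  carrier := {f | ∃ c : Matrix (Fin k) (Fin k) ℂ,
    f 0 = c ⊗ₖ cornerOne n ∧ f 1 = c ⊗ₖ (1 : Matrix (Fin n) (Fin n) ℂ)}
  add_mem' := by
    rintro f g ⟨c, hc0, hc1⟩ ⟨d, hd0, hd1⟩
    exact ⟨c + d, by simp [hc0, hd0, Matrix.add_kronecker],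
      by simp [hc1, hd1, Matrix.add_kronecker]⟩
  zero_mem' := ⟨0, by simp, by simp⟩
  mul_mem' := by
    rintro f g ⟨c, hc0, hc1⟩ ⟨d, hd0, hd1⟩
    refine ⟨c * d, ?_, ?_⟩
    · rw [ContinuousMap.mul_apply, hc0, hd0, ← Matrix.mul_kronecker_mul, cornerOne_mul_self]
    · rw [ContinuousMap.mul_apply, hc1, hd1, ← Matrix.mul_kronecker_mul, one_mul]
  smul_mem' := by
    rintro z f ⟨c, hc0, hc1⟩
    exact ⟨z • c, by simp [hc0, Matrix.smul_kronecker], by simp [hc1, Matrix.smul_kronecker]⟩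
  star_mem' := by
    rintro f ⟨c, hc0, hc1⟩
    refine ⟨c.conjTranspose, ?_, ?_⟩
    · rw [ContinuousMap.star_apply, hc0, Matrix.star_eq_conjTranspose,
        Matrix.conjTranspose_kronecker, conjTranspose_cornerOne]
    · rw [ContinuousMap.star_apply, hc1, Matrix.star_eq_conjTranspose,
        Matrix.conjTranspose_kronecker, Matrix.conjTranspose_one]

lemma isClosed_razakSubalgebra (k n : ℕ) :
    IsClosed (razakSubalgebra k n :
      Set C(I, Matrix (Fin k × Fin n) (Fin k × Fin n) ℂ)) := by
  have hc : Continuous fun f : C(I, Matrix (Fin k × Fin n) (Fin k × Fin n) ℂ) => (f 0, f 1) :=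
    (continuous_eval_const 0).prodMk (continuous_eval_const 1)
  have h := (Submodule.closed_of_finiteDimensional (LinearMap.range (razakBoundary k n))).preimage hc
  convert h using 1
  ext f
  constructor
  · rintro ⟨c, h0, h1⟩
    exact ⟨c, Prod.ext h0.symm h1.symm⟩
  · rintro ⟨c, hc⟩
    exact ⟨c, (congrArg Prod.fst hc).symm, (congrArg Prod.snd hc).symm⟩

/-- The Razak block with parameters `k` and `n`, as a `C⋆`-algebra, with the supremum norm. -/
def RazakBlock (k n : ℕ) : Type := razakSubalgebra k n

instance RazakBlock.instNonUnitalCStarAlgebra (k n : ℕ) :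
    NonUnitalCStarAlgebra (RazakBlock k n) :=
  NonUnitalStarSubalgebra.nonUnitalCStarAlgebra (razakSubalgebra k n)
    (h_closed := isClosed_razakSubalgebra k n)

/-- The order of a `C⋆`-algebra: `0 ≤ a` means that `a` is self-adjoint with spectrum in
`[0, ∞)`. -/
instance RazakBlock.instPartialOrder (k n : ℕ) : PartialOrder (RazakBlock k n) :=
  CStarAlgebra.spectralOrder (RazakBlock k n)

instance RazakBlock.instStarOrderedRing (k n : ℕ) : StarOrderedRing (RazakBlock k n) :=
  CStarAlgebra.spectralOrderedRing (RazakBlock k n)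

end RazakBlocks

section Stabilization

variable {A : Type*} [NonUnitalCStarAlgebra A] [PartialOrder A] [StarOrderedRing A]

/-- The upper left `N × N` corner of an infinite matrix over a `C⋆`-algebra `A`, as an element of
the `C⋆`-algebra `M_N(A)`. -/
def truncation (N : ℕ) (x : Matrix ℕ ℕ A) : CStarMatrix (Fin N) (Fin N) A :=
  CStarMatrix.ofMatrix fun i j => x i j

/-- The (possibly infinite) operator norm of an infinite matrix over a `C⋆`-algebra, that is, the
supremum of the `C⋆`-norms of its finite corners. -/
def stableNorm (x : Matrix ℕ ℕ A) : ENNReal :=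
  ⨆ N : ℕ, ‖truncation N x‖ₑ

/-- The set of finitely supported infinite matrices, `M_∞(A) = ⋃ N, M_N(A)`. -/
def finiteMatrices (A : Type*) [Zero A] : Set (Matrix ℕ ℕ A) :=
  {x | ∃ N : ℕ, ∀ i j, N ≤ i ∨ N ≤ j → x i j = 0}

/-- The stabilisation `A ⊗ 𝒦`, where `𝒦` is the algebra of compact operators on `ℓ²(ℕ)`: the
closure of `M_∞(A)` in the operator norm. Elements are represented by their matrices with respect
to the standard matrix units of `𝒦`. -/
def stabilization (A : Type*) [NonUnitalCStarAlgebra A] [PartialOrder A] [StarOrderedRing A] :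
    Set (Matrix ℕ ℕ A) :=
  {x | ∀ ε : ENNReal, 0 < ε → ∃ y ∈ finiteMatrices A, stableNorm (x - y) < ε}

/-- The product of `A ⊗ 𝒦`: the product of infinite matrices. -/
def stableMul (x y : Matrix ℕ ℕ A) : Matrix ℕ ℕ A :=
  fun i j => ∑' l : ℕ, x i l * y l j

/-- The embedding `a ↦ a ⊗ e₀₀` of `A` in `A ⊗ 𝒦`. -/
def stableEmbedding (a : A) : Matrix ℕ ℕ A :=
  Matrix.single 0 0 a

/-- Cuntz subequivalence `x ≾ y` of elements of `A`: there are `v_m` in `A ⊗ 𝒦` with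
`‖x - v_m y v_m⋆‖ → 0`. -/
def CuntzSubequiv (x y : A) : Prop :=
  ∃ v : ℕ → Matrix ℕ ℕ A, (∀ m, v m ∈ stabilization A) ∧
    Tendsto (fun m => stableNorm (stableEmbedding x -
      stableMul (stableMul (v m) (stableEmbedding y)) (v m).conjTranspose)) atTop (𝓝 0)

end Stabilization

section Distances

variable {A : Type*} [NonUnitalCStarAlgebra A]

/-- The element `e_s(x) = (x - s)₊`, obtained by applying the function `t ↦ max 0 (t - s)` to `x`
(where `x` is positive and `s ≥ 0`). -/
def cutDown (s : ℝ) (x : A) : A :=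
  cfcₙ (fun t : ℝ => max 0 (t - s)) x

/-- The distance between the unitary orbits of `a` and `b`:
`d_U(a, b) = inf {‖u a u⋆ - b‖ | u unitary in the unitisation of A}`. -/
def unitaryDist (a b : A) : ℝ :=
  ⨅ u : unitary (Unitization ℂ A),
    ‖(u : Unitization ℂ A) * (a : Unitization ℂ A) * star (u : Unitization ℂ A) -
      (b : Unitization ℂ A)‖

/-- The Cuntz distance
`d_W(a, b) = inf {r > 0 | e_{t+r}(a) ≾ e_t(b) and e_{t+r}(b) ≾ e_t(a) for all t > 0}`. -/
def cuntzDist [PartialOrder A] [StarOrderedRing A] (a b : A) : ℝ :=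
  sInf {r : ℝ | 0 < r ∧ ∀ t : ℝ, 0 < t →
    CuntzSubequiv (cutDown (t + r) a) (cutDown t b) ∧
    CuntzSubequiv (cutDown (t + r) b) (cutDown t a)}

end Distances

end

/-!
Write `A` for the Razak block with parameters `k` and `n`.

*The Cuntz distance is at most the distance of unitary orbits.* This half holds in every
`C⋆`-algebra. Cuntz subequivalence of elements of `A` can be tested with elements of `A` instead of
`A ⊗ 𝒦` (`cuntzSubequiv_iff`). If `‖x - y‖ < r`, then `x - r ≤ y` in the unitisation, and this
gives `(x - (t + r))₊ ≾ (y - t)₊` (`cuntzSubequiv_cutDown_of_norm_sub_lt`). It is applied to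
`x = u a u⋆` and `y = b`; conjugation by `u` does not change Cuntz classes.

*The converse.* Let `r` be admissible in the definition of the Cuntz distance. In the fibre over
`x ∈ [0,1]`, the Cuntz relations say that `a(x)` has at most as many eigenvalues above `t + r` as
`b(x)` has above `t`, and vice versa, since the rank is lower semicontinuous. Hence the decreasing
lists of eigenvalues of `a(x)` and `b(x)` differ by at most `r`
(`eigenvalue_le_add_of_cuntzSubequiv`), so that `‖U a(x) U⋆ - V b(x) V⋆‖ ≤ r` for all unitaries
`U`, `V` which diagonalise `a(x)` and `b(x)` with decreasing diagonals.

The pairs `(U, V)` cannot be chosen continuously in `x`, but they can up to `ε`: they form a closed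
set over `[0,1]`, and any two pairs over the same `x` differ by unitaries in the commutants of the
diagonal forms, which are path connected (`joinedIn_of_isSortedDiagonal`). By compactness there is
a continuous choice of `U` and `V` with prescribed endpoints such that
`‖U a U⋆ - V b V⋆‖ < r + ε` throughout (`exists_continuous_selection`,
`exists_continuous_unitaries`).

At the endpoints `a` and `b` are `c ⊗ p` and `d ⊗ p`, where `p` is `1_{n-1}` or `1_n`. If `w` and
`v` diagonalise `c` and `d`, and a permutation `P` sorts the result, then `U = P (1 + (w - 1) ⊗ p)`
and `V = P (1 + (v - 1) ⊗ p)` are admissible, and `V⋆ U = 1 + (v⋆ w - 1) ⊗ p`. As `v⋆ w` does not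
depend on the endpoint, `V⋆ U - 1` is an element of `A`, and `V⋆ U` is a unitary of the
unitisation (`unitaryDist_le_of_continuous`).
-/

noncomputable section

/-! ### Cuntz comparison in a `C⋆`-algebra -/

section CuntzComparison

lemma stableMul_stableEmbedding_stableMul_apply {A : Type*} [NonUnitalCStarAlgebra A]
    (v w : Matrix ℕ ℕ A) (y : A) (i j : ℕ) :
    stableMul (stableMul v (stableEmbedding y)) w i j = v i 0 * y * w 0 j := by
  have h : ∀ l, stableMul v (stableEmbedding y) i l = if l = 0 then v i 0 * y else 0 := by
    intro l
    unfold stableMul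
    rw [tsum_eq_single 0]
    · by_cases hl : l = 0
      · simp [hl, stableEmbedding]
      · simp [hl, stableEmbedding, Ne.symm hl]
    · intro l' hl'
      simp [stableEmbedding, Ne.symm hl']
  rw [stableMul, tsum_eq_single 0]
  · simp [h]
  · intro l hl
    simp [h, hl]

variable {A : Type*} [NonUnitalCStarAlgebra A] [PartialOrder A] [StarOrderedRing A]

/-- The corner embedding `A → M_{N+1}(A)`, `z ↦ z ⊗ e₀₀`. -/
def cornerHom (A : Type*) [NonUnitalCStarAlgebra A] [PartialOrder A] [StarOrderedRing A] (N : ℕ) :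
    A →⋆ₙₐ[ℂ] CStarMatrix (Fin (N + 1)) (Fin (N + 1)) A where
  toFun z := CStarMatrix.ofMatrix (Matrix.single 0 0 z)
  map_smul' c z := by
    ext i j
    simp [Matrix.single_apply]
  map_zero' := by
    ext i j
    simp
  map_add' z w := by
    ext i j
    simp [Matrix.single_add]
  map_mul' z w := by
    classical
    exact congrArg CStarMatrix.ofMatrix
      (Matrix.single_mul_single_same z (0 : Fin (N + 1)) (0 : Fin (N + 1)) (0 : Fin (N + 1)) w).symm
  map_star' z := by
    have h := Matrix.conjTranspose_single (0 : Fin (N + 1)) (0 : Fin (N + 1)) z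
    exact congrArg CStarMatrix.ofMatrix h.symm

lemma stableNorm_stableEmbedding_le (z : A) : stableNorm (stableEmbedding z) ≤ ‖z‖ₑ := by
  refine iSup_le fun N => ?_
  rcases N with _ | N
  · have : truncation 0 (stableEmbedding z) = 0 := by
      ext i
      exact i.elim0
    simp [this]
  · have h : truncation (N + 1) (stableEmbedding z) = cornerHom A N z := by
      ext i j
      change Matrix.single 0 0 z (i : ℕ) (j : ℕ) = Matrix.single 0 0 z i j
      simp [Matrix.single_apply, Fin.ext_iff]
    rw [h, ← ofReal_norm, ← ofReal_norm]
    exact ENNReal.ofReal_le_ofReal (NonUnitalStarAlgHom.norm_apply_le (cornerHom A N) z)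

lemma enorm_apply_zero_zero_le_stableNorm (x : Matrix ℕ ℕ A) : ‖x 0 0‖ₑ ≤ stableNorm x := by
  refine le_trans ?_ (le_iSup _ 1)
  rw [← ofReal_norm, ← ofReal_norm]
  exact ENNReal.ofReal_le_ofReal
    (CStarMatrix.norm_entry_le_norm (M := truncation 1 x) (i := 0) (j := 0))

/-- Since `x` and `y` are in the corner `A ⊗ e₀₀`, only the entries `v₀₀` of the elements
`v ∈ A ⊗ 𝒦` in the definition of Cuntz subequivalence matter. -/
lemma cuntzSubequiv_iff (x y : A) :
    CuntzSubequiv x y ↔ ∀ ε : ℝ, 0 < ε → ∃ v : A, ‖x - v * y * star v‖ < ε := by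
  constructor
  · rintro ⟨v, -, hv⟩ ε hε
    have h := hv.eventually (gt_mem_nhds (show (0 : ENNReal) < ENNReal.ofReal ε by simpa using hε))
    obtain ⟨m, hm⟩ := h.exists
    refine ⟨v m 0 0, ?_⟩
    have h1 := (enorm_apply_zero_zero_le_stableNorm _).trans_lt hm
    rw [Matrix.sub_apply, stableMul_stableEmbedding_stableMul_apply, ← ofReal_norm,
      ENNReal.ofReal_lt_ofReal_iff hε] at h1
    simpa [stableEmbedding] using h1
  · intro h
    choose w hw using fun m : ℕ => h (1 / ((m : ℝ) + 1)) (by positivity)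
    refine ⟨fun m => stableEmbedding (w m), fun m ε hε => ⟨stableEmbedding (w m), ⟨1, ?_⟩, ?_⟩, ?_⟩
    · rintro i j hij
      simp only [stableEmbedding, Matrix.single_apply]
      rw [if_neg]
      omega
    · have : stableNorm (0 : Matrix ℕ ℕ A) = 0 := by
        have h0 := stableNorm_stableEmbedding_le (0 : A)
        simpa [stableEmbedding] using h0
      rwa [sub_self, this]
    · have hb : Tendsto (fun m : ℕ => ENNReal.ofReal (1 / ((m : ℝ) + 1))) atTop (𝓝 0) := by
        simpa using ENNReal.tendsto_ofReal tendsto_one_div_add_atTop_nhds_zero_nat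
      refine tendsto_of_tendsto_of_tendsto_of_le_of_le tendsto_const_nhds hb
        (fun _ => zero_le) fun m => ?_
      have he : stableEmbedding x - stableMul (stableMul (stableEmbedding (w m))
          (stableEmbedding y)) (stableEmbedding (w m)).conjTranspose =
          stableEmbedding (x - w m * y * star (w m)) := by
        ext i j
        rw [Matrix.sub_apply, stableMul_stableEmbedding_stableMul_apply]
        by_cases hi : i = 0 <;> by_cases hj : j = 0 <;>
          simp [hi, hj, stableEmbedding, Matrix.conjTranspose_apply, eq_comm]
      simp only [he]
      refine (stableNorm_stableEmbedding_le _).trans ?_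
      rw [← ofReal_norm]
      exact ENNReal.ofReal_le_ofReal (hw m).le

open Unitization in
/-- If `0 ≤ p ≤ B`, then `v B v⋆` is close to `p` for `v = p^{1/2} (B + δ)^{-1/2}`, since
`p - v B v⋆ = p^{1/2} δ (B + δ)⁻¹ p^{1/2}` has the norm of
`(δ (B + δ)⁻¹)^{1/2} p (δ (B + δ)⁻¹)^{1/2} ≤ δ B (B + δ)⁻¹ ≤ δ`. -/
lemma cuntzSubequiv_of_le {p B : A} (hp : 0 ≤ p) (hpB : p ≤ B) : CuntzSubequiv p B := by
  rw [cuntzSubequiv_iff]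
  intro ε hε
  set δ : ℝ := ε / 2
  have hδ : 0 < δ := by positivity
  have hB : 0 ≤ B := hp.trans hpB
  set q : A := CFC.sqrt p
  have hq : 0 ≤ q := CFC.sqrt_nonneg p
  have hqq : q * q = p := CFC.sqrt_mul_sqrt_self p
  set B' : Unitization ℂ A := (B : Unitization ℂ A)
  have hB' : 0 ≤ B' := inr_nonneg_iff.2 hB
  have hB'sa : IsSelfAdjoint B' := .of_nonneg hB'
  have hspec : ∀ t ∈ spectrum ℝ B', 0 ≤ t := fun t ht => spectrum_nonneg_of_nonneg hB' ht
  -- `s = (B + δ)^{-1/2}` and `T = (δ (B + δ)⁻¹)^{1/2}`; the absolute values make the functions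
  -- continuous on all of `ℝ`
  set s : Unitization ℂ A := cfc (fun t : ℝ => (√(|t| + δ))⁻¹) B'
  set T : Unitization ℂ A := cfc (fun t : ℝ => √(δ / (|t| + δ))) B'
  have hpos : ∀ t : ℝ, 0 < |t| + δ := fun t => by positivity
  have hcs : Continuous (fun t : ℝ => (√(|t| + δ))⁻¹) := by
    refine Continuous.inv₀ (by fun_prop) fun t => (Real.sqrt_pos.2 (hpos t)).ne'
  have hcT : Continuous (fun t : ℝ => √(δ / (|t| + δ))) := by
    refine Real.continuous_sqrt.comp (Continuous.div (by fun_prop) (by fun_prop)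
      fun t => (hpos t).ne')
  have hsa : IsSelfAdjoint s := IsSelfAdjoint.cfc
  have hTa : IsSelfAdjoint T := IsSelfAdjoint.cfc
  have hid : B' = cfc (fun t : ℝ => t) B' := (cfc_id' ℝ B').symm
  have hsBs : s * B' * s = 1 - T * T := by
    have h1 : s * B' * s = cfc (fun t : ℝ => (√(|t| + δ))⁻¹ * t * (√(|t| + δ))⁻¹) B' := by
      conv_lhs => rw [hid]
      rw [← cfc_mul _ _ B' (by exact hcs.continuousOn), ← cfc_mul _ _ B' (by fun_prop)
        (by exact hcs.continuousOn)]
    have h2 : 1 - T * T = cfc (fun t : ℝ => 1 - √(δ / (|t| + δ)) * √(δ / (|t| + δ))) B' := by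
      rw [cfc_sub (fun _ => (1 : ℝ)) (fun t : ℝ => √(δ / (|t| + δ)) * √(δ / (|t| + δ))) B'
        continuousOn_const (hcT.mul hcT).continuousOn,
        cfc_const_one ℝ B' hB'sa, cfc_mul _ _ B' hcT.continuousOn hcT.continuousOn]
    rw [h1, h2]
    refine cfc_congr fun t ht => ?_
    have ht0 := hspec t ht
    have hd : 0 < t + δ := by linarith
    simp only [abs_of_nonneg ht0]
    rw [Real.mul_self_sqrt (by positivity)]
    have h3 : (√(t + δ))⁻¹ * t * (√(t + δ))⁻¹ = t / (√(t + δ) * √(t + δ)) := by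
      field_simp
    rw [h3, Real.mul_self_sqrt hd.le]
    field_simp
    ring
  have hTBT : T * B' * T = cfc (fun t : ℝ => √(δ / (|t| + δ)) * t * √(δ / (|t| + δ))) B' := by
    conv_lhs => rw [hid]
    rw [← cfc_mul _ _ B' (by exact hcT.continuousOn), ← cfc_mul _ _ B' (by fun_prop)
      (by exact hcT.continuousOn)]
  have hnorm : ‖T * B' * T‖ ≤ δ := by
    rw [hTBT]
    refine norm_cfc_le hδ.le fun t ht => ?_
    have ht0 := hspec t ht
    have hd : 0 < t + δ := by linarith
    simp only [abs_of_nonneg ht0]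
    have h3 : √(δ / (t + δ)) * t * √(δ / (t + δ)) = t * (δ / (t + δ)) := by
      rw [mul_right_comm, Real.mul_self_sqrt (by positivity), mul_comm]
    rw [h3, Real.norm_of_nonneg (by positivity), ← mul_div_assoc, div_le_iff₀ hd]
    nlinarith
  -- `q s` is in the ideal `A` of the unitisation
  obtain ⟨v, hv⟩ : ∃ v : A, (v : Unitization ℂ A) = (q : Unitization ℂ A) * s := by
    refine ⟨((q : Unitization ℂ A) * s).snd, ?_⟩
    ext <;> simp
  refine ⟨v, lt_of_le_of_lt ?_ (half_lt_self hε)⟩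
  have hqa : star q = q := (IsSelfAdjoint.of_nonneg hq).star_eq
  have hqa' : star (q : Unitization ℂ A) = q := by rw [← inr_star, hqa]
  rw [← Unitization.norm_inr (𝕜 := ℂ)]
  have hE : ((p - v * B * star v : A) : Unitization ℂ A) = star (T * q) * (T * q) := by
    rw [inr_sub, inr_mul, inr_mul, inr_star, hv, star_mul, star_mul, hsa.star_eq, hTa.star_eq,
      hqa', ← hqq, inr_mul]
    have : (q : Unitization ℂ A) * s * B' * (s * q) = q * (s * B' * s) * q := by
      simp only [mul_assoc]
    rw [this, hsBs]
    noncomm_ring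
  have hE' : T * (p : Unitization ℂ A) * T = (T * q) * star (T * q) := by
    rw [star_mul, hTa.star_eq, hqa', ← hqq, inr_mul]
    noncomm_ring
  rw [hE, CStarRing.norm_star_mul_self, ← CStarRing.norm_self_mul_star, ← hE']
  refine le_trans ?_ hnorm
  refine CStarAlgebra.norm_le_norm_of_nonneg_of_le ?_ ?_
  · rw [hE']
    exact mul_star_self_nonneg _
  · refine hTa.conjugate_le_conjugate ?_
    exact (inr_le_iff p B (.of_nonneg hp) (.of_nonneg hB)).2 hpB

lemma CuntzSubequiv.of_conjugate {p z : A} (h : A) (hp : CuntzSubequiv p (h * z * star h)) :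
    CuntzSubequiv p z := by
  rw [cuntzSubequiv_iff] at hp ⊢
  intro ε hε
  obtain ⟨v, hv⟩ := hp ε hε
  refine ⟨v * h, ?_⟩
  rw [star_mul]
  simpa only [mul_assoc] using hv

open Unitization in
/-- Rørdam's comparison: if `‖x - y‖ < r`, then `x - r` is dominated by `y` in the unitisation, so
that `(x - (t + r))₊` is Cuntz-below `(y - t)₊`. -/
lemma cuntzSubequiv_cutDown_of_norm_sub_lt {x y : A} (hx : 0 ≤ x) (hy : 0 ≤ y) {r t : ℝ}
    (hxy : ‖x - y‖ < r) (ht : 0 < t) :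
    CuntzSubequiv (cutDown (t + r) x) (cutDown t y) := by
  set r₀ := ‖x - y‖
  have hr₀ : 0 ≤ r₀ := norm_nonneg _
  -- `h` is chosen such that `h(s)² (s - t - r₀) = (s - t - r)₊`; the maximum in the denominator
  -- differs from `s - t - r₀` only where the numerator vanishes
  set hf : ℝ → ℝ := fun s => √(max 0 (s - (t + r)) / max (r - r₀) (s - (t + r₀)))
  have hden : ∀ s, 0 < max (r - r₀) (s - (t + r₀)) := fun s =>
    lt_max_of_lt_left (sub_pos.2 hxy)
  have hfc : Continuous hf := Real.continuous_sqrt.comp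
    (Continuous.div (by fun_prop) (by fun_prop) fun s => (hden s).ne')
  have hf0 : hf 0 = 0 := by
    have : max 0 (0 - (t + r)) = 0 := max_eq_left (by linarith)
    simp only [hf, this, zero_div, Real.sqrt_zero]
  set h : A := cfcₙ hf x
  have hha : IsSelfAdjoint h := IsSelfAdjoint.cfcₙ
  have hxsa : IsSelfAdjoint x := .of_nonneg hx
  have hysa : IsSelfAdjoint y := .of_nonneg hy
  have hcut0 : ∀ s : ℝ, 0 ≤ s → max 0 (0 - s) = 0 := fun s hs => max_eq_left (by linarith)
  refine CuntzSubequiv.of_conjugate h ?_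
  refine cuntzSubequiv_of_le (cfcₙ_nonneg fun s _ => le_max_left _ _) ?_
  rw [hha.star_eq]
  have hzsa : IsSelfAdjoint (cutDown t y) := IsSelfAdjoint.cfcₙ
  have hpsa : IsSelfAdjoint (cutDown (t + r) x) := IsSelfAdjoint.cfcₙ
  rw [← inr_le_iff _ _ hpsa (hzsa.conjugate_self hha), inr_mul, inr_mul]
  set x' : Unitization ℂ A := (x : Unitization ℂ A)
  set y' : Unitization ℂ A := (y : Unitization ℂ A)
  have hx'sa : IsSelfAdjoint x' := hxsa.inr ℂ
  have hy'sa : IsSelfAdjoint y' := hysa.inr ℂ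
  have hcutx : ((cutDown (t + r) x : A) : Unitization ℂ A) =
      cfc (fun s : ℝ => max 0 (s - (t + r))) x' :=
    real_cfcₙ_eq_cfc_inr x _ (hcut0 _ (by linarith))
  have hcuty : ((cutDown t y : A) : Unitization ℂ A) = cfc (fun s : ℝ => max 0 (s - t)) y' :=
    real_cfcₙ_eq_cfc_inr y _ (hcut0 _ ht.le)
  have hhx : ((h : A) : Unitization ℂ A) = cfc hf x' := real_cfcₙ_eq_cfc_inr x _ hf0
  rw [hcutx, hcuty, hhx]
  have h1 : x' - algebraMap ℝ _ (t + r₀) ≤ y' - algebraMap ℝ _ t := by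
    have h2 : x' - y' ≤ algebraMap ℝ _ r₀ := by
      have := (hx'sa.sub hy'sa).le_algebraMap_norm_self
      have hn : ‖x' - y'‖ = r₀ := by
        rw [← inr_sub, Unitization.norm_inr]
      rwa [hn] at this
    rw [map_add]
    have h3 := sub_le_iff_le_add.1 h2
    calc x' - (algebraMap ℝ _ t + algebraMap ℝ _ r₀)
        ≤ algebraMap ℝ _ r₀ + y' - (algebraMap ℝ _ t + algebraMap ℝ _ r₀) := by gcongr
      _ = _ := by abel
  have h2 : y' - algebraMap ℝ _ t ≤ cfc (fun s : ℝ => max 0 (s - t)) y' := by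
    have : y' - algebraMap ℝ _ t = cfc (fun s : ℝ => s - t) y' := by
      rw [cfc_sub _ _ y', cfc_id' ℝ y', cfc_const t y']
    rw [this]
    exact cfc_mono fun s _ => le_max_right _ _
  have h3 : cfc (fun s : ℝ => max 0 (s - (t + r))) x' =
      cfc hf x' * (x' - algebraMap ℝ _ (t + r₀)) * cfc hf x' := by
    have : x' - algebraMap ℝ _ (t + r₀) = cfc (fun s : ℝ => s - (t + r₀)) x' := by
      rw [cfc_sub _ _ x', cfc_id' ℝ x', cfc_const _ x']
    rw [this, ← cfc_mul _ _ x' (by exact hfc.continuousOn) (by fun_prop),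
      ← cfc_mul _ _ x' (by fun_prop) (by exact hfc.continuousOn)]
    refine cfc_congr fun s _ => ?_
    simp only [hf]
    rw [mul_right_comm, Real.mul_self_sqrt (div_nonneg (le_max_left _ _) (hden s).le)]
    rcases le_total s (t + r) with hs | hs
    · rw [max_eq_left (by linarith : s - (t + r) ≤ 0)]
      simp
    · rw [max_eq_right (by linarith : r - r₀ ≤ s - (t + r₀)),
        div_mul_cancel₀ _ (by linarith : s - (t + r₀) ≠ 0)]
  rw [h3]
  exact (IsSelfAdjoint.cfc (f := hf)).conjugate_le_conjugate (h1.trans h2)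

end CuntzComparison

/-! ### Approximate continuous selections over the unit interval -/

section PathSelection

open scoped unitInterval

variable {X : Type*} [TopologicalSpace X]

/-- Around each parameter `x`, the points of the fibres of `F` can be joined by paths which are
good for all parameters near `x`. -/
lemma exists_nhds_forall_joinedIn [CompactSpace X] [LocallyPathConnectedSpace X]
    {F O : Set (X × I)} (hF : IsClosed F) (hO : IsOpen O) (hne : ∀ x, ∃ p, (p, x) ∈ F)
    (hjoin : ∀ x p q, (p, x) ∈ F → (q, x) ∈ F → JoinedIn {p | (p, x) ∈ O} p q) (x : I) :
    ∃ N : Set I, IsOpen N ∧ x ∈ N ∧ ∀ y ∈ N, ∀ y' ∈ N, ∀ p q, (p, y) ∈ F → (q, y') ∈ F →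
      JoinedIn {p | ∀ z ∈ N, (p, z) ∈ O} p q := by
  obtain ⟨p₀, hp₀⟩ := hne x
  have key : ∃ N ∈ 𝓝 x, ∀ y ∈ N, ∀ q ∈ (Set.univ : Set X), (q, y) ∈ F →
      JoinedIn {p | ∀ z ∈ N, (p, z) ∈ O} p₀ q := by
    refine isCompact_univ.induction_on (p := fun S => ∃ N ∈ 𝓝 x, ∀ y ∈ N, ∀ q ∈ S, (q, y) ∈ F →
      JoinedIn {p | ∀ z ∈ N, (p, z) ∈ O} p₀ q) ⟨Set.univ, univ_mem, by simp⟩ ?_ ?_ ?_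
    · rintro S T hST ⟨N, hN, h⟩
      exact ⟨N, hN, fun y hy q hq => h y hy q (hST hq)⟩
    · rintro S T ⟨N, hN, h⟩ ⟨M, hM, h'⟩
      refine ⟨N ∩ M, inter_mem hN hM, fun y hy q hq hqF => ?_⟩
      rcases hq with hq | hq
      · exact (h y hy.1 q hq hqF).mono fun p hp z hz => hp z hz.1
      · exact (h' y hy.2 q hq hqF).mono fun p hp z hz => hp z hz.2
    · intro q _
      by_cases hq : (q, x) ∈ F
      · -- a path in the fibre of `O` over `x`, followed by a short one
        obtain ⟨γ, hγ⟩ := hjoin x p₀ q hp₀ hq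
        have hγN : ∃ N ∈ 𝓝 x, ∀ t, ∀ z ∈ N, (γ t, z) ∈ O := by
          have h1 : ∀ᶠ z in 𝓝 x, ∀ t ∈ (Set.univ : Set I), (γ t, z) ∈ O := by
            refine isCompact_univ.eventually_forall_of_forall_eventually fun t _ => ?_
            have hc : ContinuousAt (fun w : I × I => (γ w.2, w.1)) (x, t) := by fun_prop
            exact hc.eventually (hO.mem_nhds (hγ t))
          exact ⟨_, h1, fun t z hz => hz t trivial⟩
        obtain ⟨N, hN, hNO⟩ := hγN
        have hqO : O ∈ 𝓝 (q, x) := hO.mem_nhds (by simpa using hγ 1)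
        rw [nhds_prod_eq, mem_prod_iff] at hqO
        obtain ⟨B, hB, M, hM, hBM⟩ := hqO
        obtain ⟨C, ⟨hC, hCp⟩, hCB⟩ :=
          (LocallyPathConnectedSpace.path_connected_basis q).mem_iff.1 hB
        refine ⟨C, mem_nhdsWithin_of_mem_nhds hC, N ∩ M, inter_mem hN hM,
          fun y hy q' hq' _ => ?_⟩
        refine JoinedIn.trans ⟨γ, fun t z hz => hNO t z hz.1⟩ ?_
        exact (hCp.joinedIn q (mem_of_mem_nhds hC) q' hq').mono fun p hp z hz =>
          hBM ⟨hCB hp, hz.2⟩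
      · have : Fᶜ ∈ 𝓝 (q, x) := hF.isOpen_compl.mem_nhds hq
        rw [nhds_prod_eq, mem_prod_iff] at this
        obtain ⟨B, hB, N, hN, h⟩ := this
        exact ⟨B, mem_nhdsWithin_of_mem_nhds hB, N, hN, fun y hy q hq hqF =>
          absurd hqF (h ⟨hq, hy⟩)⟩
  obtain ⟨N, hN, h⟩ := key
  obtain ⟨M, hMN, hM, hx⟩ := mem_nhds_iff.1 hN
  refine ⟨M, hM, hx, fun y hy y' hy' p q hp hq => ?_⟩
  exact ((h y (hMN hy) p trivial hp).symm.trans (h y' (hMN hy') q trivial hq)).mono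
    fun p hp z hz => hp z (hMN hz)

/-- If the fibres of a closed set `F ⊆ X × [0,1]` are nonempty, and any two points of a fibre are
joined inside the corresponding fibre of an open set `O`, then `O` has a continuous selection with
prescribed endpoints in `F`. -/
lemma exists_continuous_selection [CompactSpace X] [LocallyPathConnectedSpace X]
    {F O : Set (X × I)} (hF : IsClosed F) (hO : IsOpen O) (hne : ∀ x, ∃ p, (p, x) ∈ F)
    (hjoin : ∀ x p q, (p, x) ∈ F → (q, x) ∈ F → JoinedIn {p | (p, x) ∈ O} p q)
    {p₀ p₁ : X} (hp₀ : (p₀, 0) ∈ F) (hp₁ : (p₁, 1) ∈ F) :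
    ∃ g : I → X, Continuous g ∧ g 0 = p₀ ∧ g 1 = p₁ ∧ ∀ z, (g z, z) ∈ O := by
  choose N hNo hxN hN using exists_nhds_forall_joinedIn hF hO hne hjoin
  obtain ⟨t, ht0, htm, ⟨m, hm⟩, ht⟩ := exists_monotone_Icc_subset_open_cover_unitInterval hNo
    (fun x _ => Set.mem_iUnion.2 ⟨x, hxN x⟩)
  have key : ∀ j, ∀ q, (q, t j) ∈ F → (t j = 0 → q = p₀) →
      ∃ g : I → X, Continuous g ∧ g 0 = p₀ ∧ g (t j) = q ∧ ∀ z ≤ t j, (g z, z) ∈ O := by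
    intro j
    induction j with
    | zero =>
      intro q hq h0
      obtain rfl := h0 ht0
      refine ⟨fun _ => q, continuous_const, rfl, rfl, fun z hz => ?_⟩
      have hz0 : z = t 0 := le_antisymm hz (ht0 ▸ unitInterval.nonneg')
      rw [hz0]
      exact (hjoin (t 0) q q hq hq).source_mem
    | succ j ih =>
      intro q hq hq0
      rcases (htm j.le_succ).eq_or_lt with heq | hlt
      · rw [← heq] at hq hq0 ⊢
        exact ih q hq hq0
      obtain ⟨q', hq', hj0⟩ : ∃ q', (q', t j) ∈ F ∧ (t j = 0 → q' = p₀) := by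
        by_cases hj : t j = 0
        · exact ⟨p₀, hj ▸ hp₀, fun _ => rfl⟩
        · obtain ⟨q', hq'⟩ := hne (t j)
          exact ⟨q', hq', fun h => absurd h hj⟩
      obtain ⟨g, hg, hg0, hgj, hgO⟩ := ih q' hq' hj0
      obtain ⟨i, hi⟩ := ht j
      obtain ⟨γ, hγ⟩ := hN i (t j) (hi (Set.left_mem_Icc.2 hlt.le)) (t (j + 1))
        (hi (Set.right_mem_Icc.2 hlt.le)) q' q hq' hq
      have hd : 0 < (t (j + 1) : ℝ) - t j := sub_pos.2 hlt
      set f : I → X := fun z => γ.extend (((z : ℝ) - t j) / ((t (j + 1) : ℝ) - t j))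
      have hf : Continuous f := γ.continuous_extend.comp (by fun_prop)
      refine ⟨fun z => if z ≤ t j then g z else f z, ?_, ?_, ?_, ?_⟩
      · refine Continuous.if_le hg hf continuous_id continuous_const fun z hz => ?_
        simp [hz, f, hgj]
      · simp only [if_pos (unitInterval.nonneg' (t := t j)), hg0]
      · simp only [if_neg (not_le.2 hlt), f]
        rw [div_self hd.ne', γ.extend_one]
      · intro z hz
        by_cases hzj : z ≤ t j
        · simpa only [if_pos hzj] using hgO z hzj
        · simp only [if_neg hzj]
          have hz01 : ((z : ℝ) - t j) / ((t (j + 1) : ℝ) - t j) ∈ I :=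
            ⟨div_nonneg (sub_nonneg.2 (not_le.1 hzj).le) hd.le,
              (div_le_one hd).2 (sub_le_sub_right (show (z : ℝ) ≤ t (j + 1) from hz) _)⟩
          simp only [f]
          rw [γ.extend_apply hz01]
          exact hγ _ z (hi ⟨(not_le.1 hzj).le, hz⟩)
  obtain ⟨g, hg, hg0, hg1, hgO⟩ := key m p₁ (by rw [hm m le_rfl]; exact hp₁)
    fun h => absurd (hm m le_rfl ▸ h) one_ne_zero
  rw [hm m le_rfl] at hg1 hgO
  exact ⟨g, hg, hg0, hg1, fun z => hgO z unitInterval.le_one'⟩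

end PathSelection

/-! ### Sorted diagonalisations of Hermitian matrices -/

section SortedDiagonalisation

open scoped Matrix.Norms.L2Operator unitInterval ComplexOrder

/-- A real diagonal matrix whose entries are decreasing with respect to the enumeration `e` of the
index set. -/
def IsSortedDiagonal {ι : Type*} [DecidableEq ι] {N : ℕ} (e : ι ≃ Fin N)
    (M : Matrix ι ι ℂ) : Prop :=
  ∃ α : ι → ℝ, Antitone (α ∘ e.symm) ∧ M = Matrix.diagonal fun i => (α i : ℂ)

lemma isClosed_setOf_isSortedDiagonal {ι : Type*} [DecidableEq ι] {N : ℕ} (e : ι ≃ Fin N) :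
    IsClosed {M : Matrix ι ι ℂ | IsSortedDiagonal e M} := by
  have h : {M : Matrix ι ι ℂ | IsSortedDiagonal e M} =
      {M | M = Matrix.diagonal fun i => ((M i i).re : ℂ)} ∩
        ⋂ (a : Fin N) (b : Fin N) (_ : a ≤ b),
          {M | (M (e.symm b) (e.symm b)).re ≤ (M (e.symm a) (e.symm a)).re} := by
    ext M
    simp only [Set.mem_ofPred_eq, Set.mem_inter_iff, Set.mem_iInter]
    constructor
    · rintro ⟨α, hα, rfl⟩
      refine ⟨by simp, fun a b hab => ?_⟩
      simpa using hα hab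
    · rintro ⟨h1, h2⟩
      exact ⟨fun i => (M i i).re, fun a b hab => h2 a b hab, h1⟩
  have hentry : ∀ i, Continuous fun M : Matrix ι ι ℂ => (M i i).re := fun i =>
    Complex.continuous_re.comp (continuous_id.matrix_elem i i)
  rw [h]
  refine IsClosed.inter (isClosed_eq continuous_id ?_) ?_
  · exact Continuous.matrix_diagonal (continuous_pi fun i =>
      Complex.continuous_ofReal.comp (hentry i))
  · exact isClosed_iInter fun a => isClosed_iInter fun b => isClosed_iInter fun _ =>
      isClosed_le (hentry _) (hentry _)

lemma exists_perm_monotone_comp {ι β : Type*} [LinearOrder β] {N : ℕ} (e : ι ≃ Fin N) (κ : ι → β) :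
    ∃ π : Equiv.Perm ι, Monotone (κ ∘ π ∘ e.symm) := by
  refine ⟨e.symm.permCongr (Tuple.sort (κ ∘ e.symm)), ?_⟩
  have h := Tuple.monotone_sort (κ ∘ e.symm)
  convert h using 1
  ext a
  simp

variable {ι : Type*} [Fintype ι] [DecidableEq ι] {N : ℕ}

lemma exists_unitary_conj_diagonal (π : Equiv.Perm ι) :
    ∃ P ∈ unitary (Matrix ι ι ℂ), ∀ α : ι → ℂ,
      P * Matrix.diagonal α * star P = Matrix.diagonal (α ∘ π) := by
  have h : ∀ M : Matrix ι ι ℂ, (1 : Matrix ι ι ℂ).submatrix π id * M *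
      star ((1 : Matrix ι ι ℂ).submatrix π id) = M.submatrix π π := by
    intro M
    ext i j
    simp [Matrix.mul_apply, Matrix.star_apply, Matrix.one_apply]
  refine ⟨(1 : Matrix ι ι ℂ).submatrix π id, ?_, fun α => ?_⟩
  · have h1 : (1 : Matrix ι ι ℂ).submatrix π id * star ((1 : Matrix ι ι ℂ).submatrix π id) = 1 := by
      have := h 1
      rwa [mul_one, Matrix.submatrix_one_equiv] at this
    exact Unitary.mem_iff.2 ⟨mul_eq_one_comm.1 h1, h1⟩
  · rw [h, Matrix.submatrix_diagonal_equiv]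

lemma exists_unitary_isSortedDiagonal (e : ι ≃ Fin N) {M : Matrix ι ι ℂ} (hM : M.IsHermitian) :
    ∃ U ∈ unitary (Matrix ι ι ℂ), IsSortedDiagonal e (U * M * star U) := by
  obtain ⟨π, hπ⟩ := exists_perm_monotone_comp e (OrderDual.toDual ∘ hM.eigenvalues)
  obtain ⟨P, hP, hPd⟩ := exists_unitary_conj_diagonal π
  set V : Matrix ι ι ℂ := hM.eigenvectorUnitary.1
  have hV : V ∈ unitary (Matrix ι ι ℂ) := hM.eigenvectorUnitary.2
  refine ⟨P * star V, mul_mem hP (Unitary.star_mem hV), hM.eigenvalues ∘ π, fun a b hab => hπ hab,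
    ?_⟩
  have h := hM.spectral_theorem
  rw [Unitary.conjStarAlgAut_apply] at h
  have h' : star V * M * V = Matrix.diagonal (RCLike.ofReal ∘ hM.eigenvalues) := by
    have h1 := Unitary.star_mul_self_of_mem hV
    conv_lhs => rw [h]
    calc star V * (V * Matrix.diagonal (RCLike.ofReal ∘ hM.eigenvalues) * star V) * V
        = (star V * V) * Matrix.diagonal (RCLike.ofReal ∘ hM.eigenvalues) * (star V * V) := by
          simp only [mul_assoc]
      _ = _ := by rw [h1, one_mul, mul_one]
  calc P * star V * M * star (P * star V) = P * (star V * M * V) * star P := by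
        rw [star_mul, star_star]; simp only [mul_assoc]
    _ = _ := by rw [h', hPd]; rfl

lemma charpoly_unitary_conj {U M : Matrix ι ι ℂ} (hU : U ∈ unitary (Matrix ι ι ℂ)) :
    (U * M * star U).charpoly = M.charpoly := by
  rw [Matrix.charpoly_mul_comm, ← mul_assoc, Unitary.star_mul_self_of_mem hU, one_mul]

/-- The decreasing enumeration of the eigenvalues is unique. -/
lemma eq_of_charpoly_diagonal_eq (e : ι ≃ Fin N) {α β : ι → ℝ} (hα : Antitone (α ∘ e.symm))
    (hβ : Antitone (β ∘ e.symm))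
    (h : (Matrix.diagonal fun i => (α i : ℂ)).charpoly =
      (Matrix.diagonal fun i => (β i : ℂ)).charpoly) : α = β := by
  have key : ∀ γ : ι → ℝ, (Matrix.diagonal fun i => (γ i : ℂ)).charpoly.roots =
      (List.ofFn (γ ∘ e.symm) : Multiset ℝ).map (fun x : ℝ => (x : ℂ)) := by
    intro γ
    have h1 : ∏ i, (Polynomial.X - Polynomial.C (γ i : ℂ)) =
        (((List.ofFn (γ ∘ e.symm) : Multiset ℝ).map (fun x : ℝ => (x : ℂ))).map
          fun a => Polynomial.X - Polynomial.C a).prod := by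
      rw [← Fin.univ_val_map, Multiset.map_map, Multiset.map_map, ← Equiv.prod_comp e.symm]
      rfl
    rw [Matrix.charpoly_diagonal, h1, Polynomial.roots_multiset_prod_X_sub_C]
  have h2 : (List.ofFn (α ∘ e.symm) : Multiset ℝ) = List.ofFn (β ∘ e.symm) := by
    refine Multiset.map_injective Complex.ofReal_injective ?_
    rw [← key, ← key, h]
  have h3 := List.Perm.eq_of_pairwise' hα.sortedGE_ofFn.pairwise hβ.sortedGE_ofFn.pairwise
    (Multiset.coe_eq_coe.1 h2)
  have h4 := List.ofFn_injective h3
  ext i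
  simpa using congrFun h4 (e i)

/-- In finite dimensions the unitary group of a commutant is path connected: the spectrum of a
unitary `u` is finite, so `u = exp(i h)` with `h` in the algebra generated by `u`. -/
lemma joinedIn_commutant_one (u : unitary (Matrix ι ι ℂ)) {D : Matrix ι ι ℂ}
    (hD : Commute (u : Matrix ι ι ℂ) D) :
    JoinedIn {w : unitary (Matrix ι ι ℂ) | Commute (w : Matrix ι ι ℂ) D} 1 u := by
  have harg : ContinuousOn Complex.arg (spectrum ℂ (u : Matrix ι ι ℂ)) :=
    (Matrix.finite_spectrum _).continuousOn _
  set H := Unitary.argSelfAdjoint u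
  have hH : selfAdjoint.expUnitary H = u := by
    refine Subtype.ext ?_
    rw [selfAdjoint.expUnitary_coe, Unitary.argSelfAdjoint_coe,
      ← CFC.exp_eq_normedSpace_exp (𝕜 := ℂ), ← cfc_comp_smul .., ← cfc_comp' ..]
    conv_rhs => rw [← cfc_id' ℂ (u : Matrix ι ι ℂ)]
    refine cfc_congr fun y hy => ?_
    have hy₁ : ‖y‖ = 1 := spectrum.norm_eq_one_of_unitary u.2 hy
    have hlog : Complex.I * y.arg = Complex.log y :=
      Complex.ext (by simp [Complex.log_re, hy₁]) (by simp [Complex.log_im])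
    have hy0 : y ≠ 0 := fun h => by simp [h] at hy₁
    simpa [← Complex.exp_eq_exp_ℂ, hlog] using Complex.exp_log hy0
  have hstar : Commute (star (u : Matrix ι ι ℂ)) D := by
    have h1 := Unitary.star_mul_self_of_mem u.2
    have h2 := Unitary.mul_star_self_of_mem u.2
    calc star (u : Matrix ι ι ℂ) * D
        = star (u : Matrix ι ι ℂ) * (D * u) * star (u : Matrix ι ι ℂ) := by
          rw [mul_assoc, mul_assoc, h2, mul_one]
      _ = D * star (u : Matrix ι ι ℂ) := by
          rw [← hD.eq, ← mul_assoc, h1, one_mul]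
  have hHD : Commute (H : Matrix ι ι ℂ) D := by
    rw [Unitary.argSelfAdjoint_coe]
    exact Commute.cfc hD hstar _
  have hpath : ∀ t : I, Commute
      ((selfAdjoint.expUnitary ((t : ℝ) • H) : unitary (Matrix ι ι ℂ)) : Matrix ι ι ℂ) D := by
    intro t
    rw [selfAdjoint.expUnitary_coe]
    refine (Commute.exp_right (Commute.smul_right ?_ _)).symm
    exact (hHD.smul_left (t : ℝ)).symm
  have hj : JoinedIn {w : unitary (Matrix ι ι ℂ) | Commute (w : Matrix ι ι ℂ) D} 1
      (selfAdjoint.expUnitary H) := ⟨selfAdjoint.expUnitaryPathToOne H, hpath⟩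
  rwa [hH] at hj

instance compactSpace_unitary_matrix : CompactSpace (unitary (Matrix ι ι ℂ)) := by
  refine isCompact_iff_compactSpace.1 (Metric.isCompact_of_isClosed_isBounded ?_ ?_)
  · exact isClosed_unitary
  · refine (Metric.isBounded_closedBall (x := (0 : Matrix ι ι ℂ)) (r := 1)).subset fun U hU => ?_
    cases isEmpty_or_nonempty ι
    · simp [Subsingleton.elim U 0]
    · simp [CStarRing.norm_of_mem_unitary hU]

/-- Lower semicontinuity of the rank, in the form of an estimate between ordered lists of
eigenvalues: otherwise a singular matrix would be close to an invertible one. -/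
lemma le_add_of_forall_exists_norm_sub_lt (e : ι ≃ Fin N) {α β : ι → ℝ}
    (hα : Antitone (α ∘ e.symm)) (hβ : Antitone (β ∘ e.symm)) (hβ0 : ∀ i, 0 ≤ β i) {r : ℝ}
    (h : ∀ t : ℝ, 0 < t → ∀ ε : ℝ, 0 < ε → ∃ w : Matrix ι ι ℂ,
      ‖(Matrix.diagonal fun i => ((max 0 (α i - (t + r)) : ℝ) : ℂ)) -
        w * (Matrix.diagonal fun i => ((max 0 (β i - t) : ℝ) : ℂ)) * star w‖ < ε) (i : ι) :
    α i ≤ β i + r := by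
  by_contra! hi
  -- after cutting at this level, `α j` survives for all `j` up to `i`, and `β j` only before `i`
  set t : ℝ := (β i + (α i - r)) / 2
  have ht : 0 < t := by have := hβ0 i; simp only [t]; linarith
  have ht1 : β i < t := by simp only [t]; linarith
  have ht2 : t + r < α i := by simp only [t]; linarith
  have hαj : ∀ j, e j ≤ e i → α i ≤ α j := fun j hj => by simpa using hα hj
  have hβj : ∀ j, e i ≤ e j → β j ≤ β i := fun j hj => by simpa using hβ hj
  set D : Matrix ι ι ℂ := Matrix.diagonal fun i => ((max 0 (β i - t) : ℝ) : ℂ)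
  set E : Matrix ι ι ℂ := Matrix.diagonal fun i => ((max 0 (α i - (t + r)) : ℝ) : ℂ)
  set Q : Matrix ι ι ℂ := Matrix.diagonal fun j => if e i < e j then 1 else 0
  have hsing : ∀ w : Matrix ι ι ℂ, (w * D * star w + Q).det = 0 := by
    intro w
    -- a matrix with zero `i`-th row, which agrees with `w⋆` above it and with `1` below it
    set B : Matrix ι ι ℂ := fun j l => if e j < e i then star w j l else
      if e i < e j then (1 : Matrix ι ι ℂ) j l else 0
    have hB : B.det = 0 := Matrix.det_eq_zero_of_row_eq_zero i fun j => by simp [B]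
    have hDB : D * B = D * star w := by
      ext j l
      simp only [D, Matrix.diagonal_mul]
      by_cases hj : e j < e i
      · simp [B, hj]
      · have : max 0 (β j - t) = 0 := max_eq_left (by linarith [hβj j (not_lt.1 hj)])
        simp [this]
    have hQB : Q * B = Q := by
      ext j l
      simp only [Q, Matrix.diagonal_mul]
      by_cases hj : e i < e j
      · simp [B, hj, not_lt.2 hj.le, Matrix.diagonal_apply, Matrix.one_apply]
      · simp [hj, Matrix.diagonal_apply]
    have : w * D * star w + Q = (w * D + Q) * B := by
      rw [add_mul, mul_assoc, mul_assoc, hDB, hQB]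
    rw [this, Matrix.det_mul, hB, mul_zero]
  have hclosed : IsClosed {M : Matrix ι ι ℂ | M.det = 0} :=
    isClosed_eq (continuous_id.matrix_det) continuous_const
  have hmem : E + Q ∈ closure {M : Matrix ι ι ℂ | M.det = 0} := by
    refine Metric.mem_closure_iff.2 fun ε hε => ?_
    obtain ⟨w, hw⟩ := h t ht ε hε
    refine ⟨_, hsing w, ?_⟩
    rwa [dist_eq_norm, add_sub_add_right_eq_sub]
  rw [hclosed.closure_eq, Set.mem_ofPred_eq, Matrix.diagonal_add, Matrix.det_diagonal,
    Finset.prod_eq_zero_iff] at hmem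
  obtain ⟨j, -, hj⟩ := hmem
  by_cases hji : e i < e j
  · rw [if_pos hji] at hj
    have : (max 0 (α j - (t + r)) : ℝ) + 1 = 0 := by exact_mod_cast hj
    have := le_max_left 0 (α j - (t + r))
    linarith
  · rw [if_neg hji, add_zero, Complex.ofReal_eq_zero] at hj
    have := le_max_right 0 (α j - (t + r))
    linarith [hαj j (not_lt.1 hji)]

/-- Joining two simultaneous diagonalisations of a pair of matrices: the diagonal forms agree, so
the two choices differ by unitaries which commute with them. -/
lemma joinedIn_of_isSortedDiagonal (e : ι ≃ Fin N) {a b : Matrix ι ι ℂ} {ρ : ℝ}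
    {p q : unitary (Matrix ι ι ℂ) × unitary (Matrix ι ι ℂ)}
    (hpa : IsSortedDiagonal e (p.1 * a * star (p.1 : Matrix ι ι ℂ)))
    (hpb : IsSortedDiagonal e (p.2 * b * star (p.2 : Matrix ι ι ℂ)))
    (hqa : IsSortedDiagonal e (q.1 * a * star (q.1 : Matrix ι ι ℂ)))
    (hqb : IsSortedDiagonal e (q.2 * b * star (q.2 : Matrix ι ι ℂ)))
    (hρ : ‖(p.1 * a * star (p.1 : Matrix ι ι ℂ) - p.2 * b * star (p.2 : Matrix ι ι ℂ))‖ < ρ) :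
    JoinedIn {u : unitary (Matrix ι ι ℂ) × unitary (Matrix ι ι ℂ) |
      ‖(u.1 * a * star (u.1 : Matrix ι ι ℂ) - u.2 * b * star (u.2 : Matrix ι ι ℂ))‖ < ρ} p q := by
  have key : ∀ (c : Matrix ι ι ℂ) (u v : unitary (Matrix ι ι ℂ)),
      IsSortedDiagonal e (u * c * star (u : Matrix ι ι ℂ)) →
      IsSortedDiagonal e (v * c * star (v : Matrix ι ι ℂ)) →
      ∃ γ : Path u v, ∀ t, (γ t : Matrix ι ι ℂ) * c * star (γ t : Matrix ι ι ℂ) =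
        u * c * star (u : Matrix ι ι ℂ) := by
    intro c u v hu hv
    have huv : (u : Matrix ι ι ℂ) * c * star (u : Matrix ι ι ℂ) =
        v * c * star (v : Matrix ι ι ℂ) := by
      obtain ⟨α, hα, hα'⟩ := hu
      obtain ⟨β, hβ, hβ'⟩ := hv
      have : α = β := eq_of_charpoly_diagonal_eq e hα hβ (by
        rw [← hα', ← hβ', charpoly_unitary_conj u.2, charpoly_unitary_conj v.2])
      rw [hα', hβ', this]
    set D := (u : Matrix ι ι ℂ) * c * star (u : Matrix ι ι ℂ)
    have hu1 := Unitary.star_mul_self_of_mem u.2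
    have hv1 := Unitary.star_mul_self_of_mem v.2
    have hcomm : Commute ((v * star u : unitary (Matrix ι ι ℂ)) : Matrix ι ι ℂ) D := by
      change (v : Matrix ι ι ℂ) * star (u : Matrix ι ι ℂ) * D =
        D * ((v : Matrix ι ι ℂ) * star (u : Matrix ι ι ℂ))
      conv_rhs => rw [huv]
      calc (v : Matrix ι ι ℂ) * star (u : Matrix ι ι ℂ) * D
          = v * (star (u : Matrix ι ι ℂ) * u) * c * star (u : Matrix ι ι ℂ) := by
            simp only [D, mul_assoc]
        _ = v * c * (star (v : Matrix ι ι ℂ) * v) * star (u : Matrix ι ι ℂ) := by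
            rw [hu1, hv1, mul_one, mul_one]
        _ = _ := by simp only [mul_assoc]
    obtain ⟨γ, hγ⟩ := joinedIn_commutant_one (v * star u) hcomm
    refine ⟨(γ.map (f := fun w => w * u) (by fun_prop)).cast (by simp) (by simp [mul_assoc]),
      fun t => ?_⟩
    have h1 : (γ t : Matrix ι ι ℂ) * D = D * γ t := hγ t
    have h2 := Unitary.mul_star_self_of_mem (γ t).2
    simp only [Path.cast_coe, Path.map_coe, Function.comp_apply, Submonoid.coe_mul, star_mul]
    calc (γ t : Matrix ι ι ℂ) * u * c * (star (u : Matrix ι ι ℂ) * star (γ t : Matrix ι ι ℂ))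
        = γ t * D * star (γ t : Matrix ι ι ℂ) := by simp only [D, mul_assoc]
      _ = D := by rw [h1, mul_assoc, h2, mul_one]
  obtain ⟨γ₁, h₁⟩ := key a p.1 q.1 hpa hqa
  obtain ⟨γ₂, h₂⟩ := key b p.2 q.2 hpb hqb
  refine ⟨γ₁.prod γ₂, fun t => ?_⟩
  change ‖(γ₁ t : Matrix ι ι ℂ) * a * star (γ₁ t : Matrix ι ι ℂ) -
    (γ₂ t : Matrix ι ι ℂ) * b * star (γ₂ t : Matrix ι ι ℂ)‖ < ρ
  rwa [h₁, h₂]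

lemma exists_unitary_conj_eq_diagonal_of_posSemidef {k : ℕ} {M : Matrix (Fin k) (Fin k) ℂ}
    (hM : M.PosSemidef) :
    ∃ W ∈ unitary (Matrix (Fin k) (Fin k) ℂ), ∃ l : Fin k → ℝ, Antitone l ∧ (∀ i, 0 ≤ l i) ∧
      W * M * star W = Matrix.diagonal fun i => (l i : ℂ) := by
  obtain ⟨W, hW, l, hl, hl'⟩ := exists_unitary_isSortedDiagonal (Equiv.refl (Fin k)) hM.1
  refine ⟨W, hW, l, hl, fun i => ?_, hl'⟩
  have h1 := (hM.mul_mul_conjTranspose_same W).diag_nonneg (i := i)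
  rw [← Matrix.star_eq_conjTranspose, hl', Matrix.diagonal_apply_eq] at h1
  exact_mod_cast h1

/-- Sorted diagonalisations of two paths of Hermitian matrices can be followed by continuous paths
of unitaries with prescribed endpoints, up to an arbitrarily small error in the difference of the
two conjugated paths. -/
lemma exists_continuous_unitaries (e : ι ≃ Fin N) {a b : I → Matrix ι ι ℂ} (ha : Continuous a)
    (hb : Continuous b) (hah : ∀ x, (a x).IsHermitian) (hbh : ∀ x, (b x).IsHermitian) {ρ : ℝ}
    (hρ : ∀ x, ∀ U V : unitary (Matrix ι ι ℂ),
      IsSortedDiagonal e (U * a x * star (U : Matrix ι ι ℂ)) →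
      IsSortedDiagonal e (V * b x * star (V : Matrix ι ι ℂ)) →
      ‖U * a x * star (U : Matrix ι ι ℂ) - V * b x * star (V : Matrix ι ι ℂ)‖ < ρ)
    {U₀ V₀ U₁ V₁ : unitary (Matrix ι ι ℂ)}
    (hU₀ : IsSortedDiagonal e (U₀ * a 0 * star (U₀ : Matrix ι ι ℂ)))
    (hV₀ : IsSortedDiagonal e (V₀ * b 0 * star (V₀ : Matrix ι ι ℂ)))
    (hU₁ : IsSortedDiagonal e (U₁ * a 1 * star (U₁ : Matrix ι ι ℂ)))
    (hV₁ : IsSortedDiagonal e (V₁ * b 1 * star (V₁ : Matrix ι ι ℂ))) :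
    ∃ U V : I → unitary (Matrix ι ι ℂ), Continuous U ∧ Continuous V ∧ U 0 = U₀ ∧ V 0 = V₀ ∧
      U 1 = U₁ ∧ V 1 = V₁ ∧ ∀ x,
        ‖U x * a x * star (U x : Matrix ι ι ℂ) - V x * b x * star (V x : Matrix ι ι ℂ)‖ < ρ := by
  have hU : Continuous fun z : (unitary (Matrix ι ι ℂ) × unitary (Matrix ι ι ℂ)) × I =>
      (z.1.1 : Matrix ι ι ℂ) := continuous_subtype_val.comp (continuous_fst.comp continuous_fst)
  have hV : Continuous fun z : (unitary (Matrix ι ι ℂ) × unitary (Matrix ι ι ℂ)) × I =>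
      (z.1.2 : Matrix ι ι ℂ) := continuous_subtype_val.comp (continuous_snd.comp continuous_fst)
  have hca : Continuous fun z : (unitary (Matrix ι ι ℂ) × unitary (Matrix ι ι ℂ)) × I =>
      (z.1.1 : Matrix ι ι ℂ) * a z.2 * star (z.1.1 : Matrix ι ι ℂ) :=
    (hU.mul (ha.comp continuous_snd)).mul hU.star
  have hcb : Continuous fun z : (unitary (Matrix ι ι ℂ) × unitary (Matrix ι ι ℂ)) × I =>
      (z.1.2 : Matrix ι ι ℂ) * b z.2 * star (z.1.2 : Matrix ι ι ℂ) :=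
    (hV.mul (hb.comp continuous_snd)).mul hV.star
  have hF : IsClosed {z : (unitary (Matrix ι ι ℂ) × unitary (Matrix ι ι ℂ)) × I |
      IsSortedDiagonal e (z.1.1 * a z.2 * star (z.1.1 : Matrix ι ι ℂ)) ∧
      IsSortedDiagonal e (z.1.2 * b z.2 * star (z.1.2 : Matrix ι ι ℂ))} :=
    ((isClosed_setOf_isSortedDiagonal e).preimage hca).inter
      ((isClosed_setOf_isSortedDiagonal e).preimage hcb)
  have hO : IsOpen {z : (unitary (Matrix ι ι ℂ) × unitary (Matrix ι ι ℂ)) × I |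
      ‖z.1.1 * a z.2 * star (z.1.1 : Matrix ι ι ℂ) -
        z.1.2 * b z.2 * star (z.1.2 : Matrix ι ι ℂ)‖ < ρ} :=
    isOpen_lt (hca.sub hcb).norm continuous_const
  obtain ⟨g, hg, hg0, hg1, hgO⟩ := exists_continuous_selection hF hO
    (fun x => by
      obtain ⟨U, hU, hU'⟩ := exists_unitary_isSortedDiagonal e (hah x)
      obtain ⟨V, hV, hV'⟩ := exists_unitary_isSortedDiagonal e (hbh x)
      exact ⟨(⟨U, hU⟩, ⟨V, hV⟩), hU', hV'⟩)
    (fun x p q hp hq => joinedIn_of_isSortedDiagonal (a := a x) (b := b x) (p := p) (q := q) e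
      hp.1 hp.2 hq.1 hq.2 (hρ x p.1 p.2 hp.1 hp.2))
    (p₀ := (U₀, V₀)) (p₁ := (U₁, V₁)) ⟨hU₀, hV₀⟩ ⟨hU₁, hV₁⟩
  exact ⟨fun x => (g x).1, fun x => (g x).2, continuous_fst.comp hg, continuous_snd.comp hg,
    congrArg Prod.fst hg0, congrArg Prod.snd hg0, congrArg Prod.fst hg1, congrArg Prod.snd hg1,
    hgO⟩

end SortedDiagonalisation

/-! ### Cuntz distance and unitary orbits -/

section UnitaryInvariance

open Unitization

lemma map_cutDown {A B : Type*} [NonUnitalCStarAlgebra A] [NonUnitalCStarAlgebra B]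
    (φ : A →⋆ₙₐ[ℂ] B) {s : ℝ} (hs : 0 ≤ s) {a : A} (ha : IsSelfAdjoint a) :
    φ (cutDown s a) = cutDown s (φ a) := by
  have h0 : max 0 (0 - s) = 0 := max_eq_left (by linarith)
  exact NonUnitalStarAlgHom.map_cfcₙ φ (fun t : ℝ => max 0 (t - s)) a (by fun_prop) h0
    (AddMonoidHomClass.continuous_of_bound φ 1 fun b => by
      simpa using NonUnitalStarAlgHom.norm_apply_le φ b) ha (ha.map φ)

/-- Conjugation by a unitary, as a star homomorphism. -/
def conjStarHom {B : Type*} [CStarAlgebra B] (u : unitary B) : B →⋆ₙₐ[ℂ] B where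
  toFun x := u * x * star (u : B)
  map_smul' c x := map_smul (Unitary.conjStarAlgAut ℂ B u) c x
  map_zero' := map_zero (Unitary.conjStarAlgAut ℂ B u)
  map_add' := map_add (Unitary.conjStarAlgAut ℂ B u)
  map_mul' := map_mul (Unitary.conjStarAlgAut ℂ B u)
  map_star' := map_star (Unitary.conjStarAlgAut ℂ B u)

variable {A : Type*} [NonUnitalCStarAlgebra A]

/-- `A` is an ideal of its unitisation. -/
lemma exists_inr_eq_mul_inr (u : Unitization ℂ A) (a : A) :
    ∃ c : A, (c : Unitization ℂ A) = u * a :=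
  ⟨(u * a).snd, by ext <;> simp⟩

lemma exists_inr_eq_inr_mul (u : Unitization ℂ A) (a : A) :
    ∃ c : A, (c : Unitization ℂ A) = a * u :=
  ⟨(a * u).snd, by ext <;> simp⟩

lemma inr_cutDown_of_inr_eq_conj {u : unitary (Unitization ℂ A)} {x a : A}
    (ha : IsSelfAdjoint a)
    (hx : (x : Unitization ℂ A) = u * a * star (u : Unitization ℂ A)) {s : ℝ} (hs : 0 ≤ s) :
    ((cutDown s x : A) : Unitization ℂ A) = u * (cutDown s a : A) * star (u : Unitization ℂ A) := by
  set ψ : A →⋆ₙₐ[ℂ] Unitization ℂ A := inrNonUnitalStarAlgHom ℂ A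
  set c : Unitization ℂ A →⋆ₙₐ[ℂ] Unitization ℂ A :=
    conjStarHom u
  have hxsa : IsSelfAdjoint x := by
    rw [← isSelfAdjoint_inr (R := ℂ), hx]
    exact (ha.inr ℂ).conjugate _
  have h1 : ψ (cutDown s x) = cutDown s (ψ x) := map_cutDown ψ hs hxsa
  have h2 : ψ (cutDown s a) = cutDown s (ψ a) := map_cutDown ψ hs ha
  have h3 : c (cutDown s (ψ a)) = cutDown s (c (ψ a)) := map_cutDown c hs (ha.inr ℂ)
  have h4 : ψ x = c (ψ a) := hx
  calc ψ (cutDown s x) = c (ψ (cutDown s a)) := by rw [h1, h4, ← h3, h2]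
    _ = _ := rfl

variable [PartialOrder A] [StarOrderedRing A]

lemma CuntzSubequiv.of_conj_left {u : unitary (Unitization ℂ A)} {x y z : A}
    (hx : (x : Unitization ℂ A) = u * y * star (u : Unitization ℂ A)) (h : CuntzSubequiv x z) :
    CuntzSubequiv y z := by
  rw [cuntzSubequiv_iff] at h ⊢
  intro ε hε
  obtain ⟨v, hv⟩ := h ε hε
  obtain ⟨w, hw⟩ := exists_inr_eq_mul_inr (star (u : Unitization ℂ A)) v
  refine ⟨w, ?_⟩
  have hu := Unitary.star_mul_self_of_mem u.2
  rw [← Unitization.norm_inr (𝕜 := ℂ)] at hv ⊢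
  have : ((y - w * z * star w : A) : Unitization ℂ A) =
      star (u : Unitization ℂ A) * ((x - v * z * star v : A) : Unitization ℂ A) * u := by
    rw [inr_sub, inr_sub, hx, inr_mul, inr_mul, inr_mul, inr_mul, inr_star, inr_star, hw, star_mul,
      star_star, mul_sub, sub_mul]
    congr 1
    · calc (y : Unitization ℂ A)
          = (star (u : Unitization ℂ A) * u) * y * (star (u : Unitization ℂ A) * u) := by
            rw [hu, one_mul, mul_one]
        _ = _ := by simp only [mul_assoc]
    · simp only [mul_assoc]
  rw [this]
  rwa [CStarRing.norm_mul_mem_unitary _ u.2,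
    CStarRing.norm_mem_unitary_mul _ (Unitary.star_mem u.2)]

lemma CuntzSubequiv.of_conj_right {u : unitary (Unitization ℂ A)} {x y z : A}
    (hx : (x : Unitization ℂ A) = u * y * star (u : Unitization ℂ A)) (h : CuntzSubequiv z x) :
    CuntzSubequiv z y := by
  rw [cuntzSubequiv_iff] at h ⊢
  intro ε hε
  obtain ⟨v, hv⟩ := h ε hε
  obtain ⟨w, hw⟩ := exists_inr_eq_inr_mul (u : Unitization ℂ A) v
  refine ⟨w, ?_⟩
  have : w * y * star w = v * x * star v := by
    refine inr_injective (R := ℂ) ?_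
    rw [inr_mul, inr_mul, inr_mul, inr_mul, inr_star, inr_star, hw, hx, star_mul]
    simp only [mul_assoc]
  rwa [this]

/-- The distance between unitary orbits dominates the Cuntz distance. -/
lemma cuntzDist_le_unitaryDist {a b : A} (ha : 0 ≤ a) (hb : 0 ≤ b) :
    cuntzDist a b ≤ unitaryDist a b := by
  refine le_ciInf fun u => le_of_forall_pos_le_add fun ε hε => ?_
  have hasa : IsSelfAdjoint a := .of_nonneg ha
  obtain ⟨x, hx⟩ : ∃ x : A, (x : Unitization ℂ A) = u * a * star (u : Unitization ℂ A) := by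
    obtain ⟨c, hc⟩ := exists_inr_eq_mul_inr (u : Unitization ℂ A) a
    obtain ⟨x, hx⟩ := exists_inr_eq_inr_mul (star (u : Unitization ℂ A)) c
    exact ⟨x, by rw [hx, hc]⟩
  have hx0 : 0 ≤ x := by
    rw [← inr_nonneg_iff, hx]
    exact star_right_conjugate_nonneg (inr_nonneg_iff.2 ha) _
  have hn : ‖(u : Unitization ℂ A) * a * star (u : Unitization ℂ A) - b‖ = ‖x - b‖ := by
    rw [← hx, ← inr_sub, Unitization.norm_inr]
  rw [hn]
  refine csInf_le ⟨0, fun r hr => hr.1.le⟩ ⟨by positivity, fun t ht => ⟨?_, ?_⟩⟩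
  · exact CuntzSubequiv.of_conj_left (inr_cutDown_of_inr_eq_conj hasa hx (by positivity))
      (cuntzSubequiv_cutDown_of_norm_sub_lt hx0 hb (by linarith) ht)
  · exact CuntzSubequiv.of_conj_right (inr_cutDown_of_inr_eq_conj hasa hx ht.le)
      (cuntzSubequiv_cutDown_of_norm_sub_lt hb hx0 (by rw [norm_sub_rev]; linarith) ht)

end UnitaryInvariance

/-! ### Fibres of a Razak block -/

section Fibres

open scoped Kronecker Matrix.Norms.L2Operator unitInterval ComplexOrder

lemma cutDown_diagonal {ι : Type*} [Fintype ι] [DecidableEq ι] (α : ι → ℝ) {s : ℝ} (hs : 0 ≤ s) :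
    cutDown s (Matrix.diagonal fun i => (α i : ℂ)) =
      Matrix.diagonal fun i => ((max 0 (α i - s) : ℝ) : ℂ) := by
  set φ : (ι → ℂ) →⋆ₙₐ[ℂ] Matrix ι ι ℂ :=
    { toFun := Matrix.diagonal
      map_smul' := fun c d => Matrix.diagonal_smul c d
      map_zero' := Matrix.diagonal_zero
      map_add' := fun c d => (Matrix.diagonal_add c d).symm
      map_mul' := fun c d => (Matrix.diagonal_mul_diagonal c d).symm
      map_star' := fun c => (Matrix.diagonal_conjTranspose c).symm }
  have hsa : IsSelfAdjoint fun i => (α i : ℂ) := by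
    ext i
    simp
  have h := map_cutDown φ hs hsa
  refine h.symm.trans (congrArg Matrix.diagonal ?_)
  ext i
  have h1 := map_cutDown (Pi.evalStarAlgHom ℂ (fun _ : ι => ℂ) i).toNonUnitalStarAlgHom
    hs hsa
  refine h1.trans ?_
  change cutDown s (α i : ℂ) = _
  have h0 : max 0 (0 - s) = 0 := max_eq_left (by linarith)
  rw [cutDown, cfcₙ_eq_cfc (hf := by fun_prop) (hf0 := h0)]
  exact cfc_algebraMap (α i) fun t : ℝ => max 0 (t - s)

variable {k n : ℕ}

/-- Evaluation of the elements of a Razak block at a point of `[0,1]`. -/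
def razakEval (k n : ℕ) (x : I) :
    RazakBlock k n →⋆ₙₐ[ℂ] Matrix (Fin k × Fin n) (Fin k × Fin n) ℂ where
  toFun a := a.1 x
  map_smul' _ _ := rfl
  map_zero' := rfl
  map_add' _ _ := rfl
  map_mul' _ _ := rfl
  map_star' _ := rfl

lemma continuous_razakEval (a : RazakBlock k n) : Continuous fun x => razakEval k n x a :=
  a.1.continuous

lemma razakEval_ext {a b : RazakBlock k n} (h : ∀ x, razakEval k n x a = razakEval k n x b) :
    a = b :=
  Subtype.ext (ContinuousMap.ext h)

lemma RazakBlock.norm_le_of_forall {a : RazakBlock k n} {C : ℝ} (hC : 0 ≤ C)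
    (h : ∀ x, ‖razakEval k n x a‖ ≤ C) : ‖a‖ ≤ C :=
  (ContinuousMap.norm_le a.1 hC).2 h

lemma posSemidef_razakEval {a : RazakBlock k n} (ha : 0 ≤ a) (x : I) :
    (razakEval k n x a).PosSemidef := by
  obtain ⟨s, rfl⟩ := CStarAlgebra.nonneg_iff_eq_star_mul_self.1 ha
  rw [map_mul, map_star]
  exact Matrix.posSemidef_conjTranspose_mul_self _

/-- The Cuntz relations between the cut-downs of `a` and `b` bound the difference of the ordered
eigenvalues of `a` and `b` in every fibre. -/
lemma eigenvalue_le_add_of_cuntzSubequiv {a b : RazakBlock k n} (ha : 0 ≤ a) (hb : 0 ≤ b) {r : ℝ}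
    (hr : 0 < r)
    (h : ∀ t : ℝ, 0 < t → CuntzSubequiv (cutDown (t + r) a) (cutDown t b)) {N : ℕ}
    (e : Fin k × Fin n ≃ Fin N) (x : I)
    {U V : unitary (Matrix (Fin k × Fin n) (Fin k × Fin n) ℂ)} {α β : Fin k × Fin n → ℝ}
    (hα : Antitone (α ∘ e.symm)) (hβ : Antitone (β ∘ e.symm))
    (hU : U * razakEval k n x a * star (U : Matrix (Fin k × Fin n) (Fin k × Fin n) ℂ) =
      Matrix.diagonal fun i => (α i : ℂ))
    (hV : V * razakEval k n x b * star (V : Matrix (Fin k × Fin n) (Fin k × Fin n) ℂ) =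
      Matrix.diagonal fun i => (β i : ℂ)) (i : Fin k × Fin n) : α i ≤ β i + r := by
  have hβ0 : ∀ i, 0 ≤ β i := by
    intro i
    have h1 := ((posSemidef_razakEval hb x).mul_mul_conjTranspose_same
      (V : Matrix (Fin k × Fin n) (Fin k × Fin n) ℂ)).diag_nonneg (i := i)
    rw [← Matrix.star_eq_conjTranspose, hV, Matrix.diagonal_apply_eq] at h1
    exact_mod_cast h1
  have hcut : ∀ (c : RazakBlock k n) (_ : 0 ≤ c)
      (W : unitary (Matrix (Fin k × Fin n) (Fin k × Fin n) ℂ)) (γ : Fin k × Fin n → ℝ)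
      (_ : W * razakEval k n x c * star (W : Matrix (Fin k × Fin n) (Fin k × Fin n) ℂ) =
        Matrix.diagonal fun i => (γ i : ℂ)) (s : ℝ), 0 ≤ s →
      (Matrix.diagonal fun i => ((max 0 (γ i - s) : ℝ) : ℂ)) =
        W * razakEval k n x (cutDown s c) *
          star (W : Matrix (Fin k × Fin n) (Fin k × Fin n) ℂ) := by
    intro c hc W γ hγ s hs
    have hcsa : IsSelfAdjoint c := .of_nonneg hc
    set ψ : Matrix (Fin k × Fin n) (Fin k × Fin n) ℂ →⋆ₙₐ[ℂ] _ :=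
      conjStarHom W
    have h1 : ψ (cutDown s (razakEval k n x c)) = cutDown s (ψ (razakEval k n x c)) :=
      map_cutDown ψ hs (hcsa.map _)
    have h2 : ψ (razakEval k n x c) = Matrix.diagonal fun i => (γ i : ℂ) := hγ
    rw [← cutDown_diagonal γ hs, ← h2, ← h1, ← map_cutDown _ hs hcsa]
    rfl
  refine le_add_of_forall_exists_norm_sub_lt e hα hβ hβ0 (fun t ht ε hε => ?_) i
  obtain ⟨v, hv⟩ := (cuntzSubequiv_iff _ _).1 (h t ht) ε hε
  refine ⟨U * razakEval k n x v * star (V : Matrix (Fin k × Fin n) (Fin k × Fin n) ℂ), ?_⟩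
  rw [hcut a ha U α hU _ (by positivity), hcut b hb V β hV t ht.le]
  have hV1 := Unitary.star_mul_self_of_mem V.2
  have key : (U : Matrix (Fin k × Fin n) (Fin k × Fin n) ℂ) * razakEval k n x (cutDown (t + r) a) *
        star (U : Matrix (Fin k × Fin n) (Fin k × Fin n) ℂ) -
      U * razakEval k n x v * star (V : Matrix (Fin k × Fin n) (Fin k × Fin n) ℂ) *
        (V * razakEval k n x (cutDown t b) *
          star (V : Matrix (Fin k × Fin n) (Fin k × Fin n) ℂ)) *
        star (U * razakEval k n x v * star (V : Matrix (Fin k × Fin n) (Fin k × Fin n) ℂ)) =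
      U * razakEval k n x (cutDown (t + r) a - v * cutDown t b * star v) *
        star (U : Matrix (Fin k × Fin n) (Fin k × Fin n) ℂ) := by
    rw [map_sub, map_mul, map_mul, map_star, mul_sub, sub_mul, star_mul, star_mul, star_star]
    congr 1
    calc _ = U * razakEval k n x v * (star (V : Matrix (Fin k × Fin n) (Fin k × Fin n) ℂ) * V) *
          razakEval k n x (cutDown t b) *
          (star (V : Matrix (Fin k × Fin n) (Fin k × Fin n) ℂ) * V) *
          (star (razakEval k n x v) *
            star (U : Matrix (Fin k × Fin n) (Fin k × Fin n) ℂ)) := by simp only [mul_assoc]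
      _ = _ := by rw [hV1]; simp only [mul_assoc, mul_one]
  rw [key, CStarRing.norm_mul_mem_unitary _ (Unitary.star_mem U.2),
    CStarRing.norm_mem_unitary_mul _ U.2]
  exact (NonUnitalStarAlgHom.norm_apply_le (razakEval k n x) _).trans_lt hv

end Fibres

/-! ### Boundary values -/

section Boundary

open scoped Kronecker Matrix.Norms.L2Operator unitInterval ComplexOrder

variable {k n : ℕ}

/-- The projection in `M_n` onto the coordinates which satisfy `χ`. Both boundary conditions of a
Razak block are of the form `c ⊗ p` for such a projection `p`. -/
def coordProj (χ : Fin n → Prop) [DecidablePred χ] : Matrix (Fin n) (Fin n) ℂ :=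
  Matrix.diagonal fun j => if χ j then 1 else 0

/-- The element `w ⊗ p + 1 ⊗ (1 - p)`, which is unitary if `w` is unitary and `p` a projection. -/
def ampliation (p : Matrix (Fin n) (Fin n) ℂ) (w : Matrix (Fin k) (Fin k) ℂ) :
    Matrix (Fin k × Fin n) (Fin k × Fin n) ℂ :=
  1 + (w - 1) ⊗ₖ p

section CoordProj

variable (χ : Fin n → Prop) [DecidablePred χ]

lemma coordProj_mul_self : coordProj χ * coordProj χ = coordProj χ := by
  rw [coordProj, Matrix.diagonal_mul_diagonal]
  congr 1
  ext j
  by_cases h : χ j <;> simp [h]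

lemma star_coordProj : star (coordProj χ) = coordProj χ := by
  rw [coordProj, Matrix.star_eq_conjTranspose, Matrix.diagonal_conjTranspose]
  congr 1
  ext j
  by_cases h : χ j <;> simp [h]

lemma ampliation_mul_kronecker (w c : Matrix (Fin k) (Fin k) ℂ) :
    ampliation (coordProj χ) w * (c ⊗ₖ coordProj χ) = (w * c) ⊗ₖ coordProj χ := by
  rw [ampliation, add_mul, one_mul, ← Matrix.mul_kronecker_mul, coordProj_mul_self,
    ← Matrix.add_kronecker]
  congr 1
  noncomm_ring

lemma ampliation_mul_ampliation (w v : Matrix (Fin k) (Fin k) ℂ) :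
    ampliation (coordProj χ) w * ampliation (coordProj χ) v =
      ampliation (coordProj χ) (w * v) := by
  conv_lhs => rw [ampliation.eq_def _ v, mul_add, mul_one, ampliation_mul_kronecker]
  rw [ampliation, ampliation, add_assoc, ← Matrix.add_kronecker]
  congr 2
  noncomm_ring

lemma star_ampliation (w : Matrix (Fin k) (Fin k) ℂ) :
    star (ampliation (coordProj χ) w) = ampliation (coordProj χ) (star w) := by
  have h := star_coordProj χ
  rw [Matrix.star_eq_conjTranspose] at h
  simp only [ampliation, Matrix.star_eq_conjTranspose, Matrix.conjTranspose_add,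
    Matrix.conjTranspose_one, Matrix.conjTranspose_kronecker, Matrix.conjTranspose_sub, h]

lemma ampliation_mem_unitary {w : Matrix (Fin k) (Fin k) ℂ}
    (hw : w ∈ unitary (Matrix (Fin k) (Fin k) ℂ)) :
    ampliation (coordProj χ) w ∈ unitary (Matrix (Fin k × Fin n) (Fin k × Fin n) ℂ) := by
  have h1 : ampliation (k := k) (coordProj χ) 1 = 1 := by simp [ampliation]
  rw [Unitary.mem_iff, star_ampliation, ampliation_mul_ampliation, ampliation_mul_ampliation,
    Unitary.star_mul_self_of_mem hw, Unitary.mul_star_self_of_mem hw]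
  exact ⟨h1, h1⟩

lemma ampliation_conj_kronecker (w c : Matrix (Fin k) (Fin k) ℂ) :
    ampliation (coordProj χ) w * (c ⊗ₖ coordProj χ) * star (ampliation (coordProj χ) w) =
      (w * c * star w) ⊗ₖ coordProj χ := by
  have hs : ∀ d : Matrix (Fin k) (Fin k) ℂ, star (d ⊗ₖ coordProj χ) = star d ⊗ₖ coordProj χ := by
    intro d
    rw [Matrix.star_eq_conjTranspose, Matrix.conjTranspose_kronecker,
      ← Matrix.star_eq_conjTranspose, ← Matrix.star_eq_conjTranspose, star_coordProj]
  rw [ampliation_mul_kronecker]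
  refine star_injective ?_
  rw [star_mul, star_star, hs, ampliation_mul_kronecker, hs, star_mul (w * c), star_star]

/-- A permutation which sorts `λ ⊗ p` for all decreasing `λ ≥ 0` at once. -/
lemma exists_unitary_sorting_kronecker (e : Fin k × Fin n ≃ Fin (k * n)) :
    ∃ P ∈ unitary (Matrix (Fin k × Fin n) (Fin k × Fin n) ℂ), ∀ l : Fin k → ℝ, Antitone l →
      (∀ i, 0 ≤ l i) → IsSortedDiagonal e
        (P * ((Matrix.diagonal fun i => (l i : ℂ)) ⊗ₖ coordProj χ) * star P) := by
  -- the zeros outside the range of `p` go last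
  set κ : Fin k × Fin n → ℕ := fun x => if χ x.2 then x.1 else k
  obtain ⟨π, hπ⟩ := exists_perm_monotone_comp e κ
  obtain ⟨P, hP, hPd⟩ := exists_unitary_conj_diagonal π
  refine ⟨P, hP, fun l hl hl0 => ?_⟩
  set f : ℕ → ℝ := fun m => if h : m < k then l ⟨m, h⟩ else 0
  have hf : Antitone f := by
    intro a b hab
    by_cases hb : b < k
    · have ha : a < k := hab.trans_lt hb
      simp only [f, dif_pos ha, dif_pos hb]
      exact hl hab
    · simp only [f, dif_neg hb]
      split_ifs
      · exact hl0 _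
      · exact le_rfl
  have hd : (Matrix.diagonal fun i => (l i : ℂ)) ⊗ₖ coordProj χ =
      Matrix.diagonal fun x => ((f (κ x) : ℝ) : ℂ) := by
    rw [coordProj, Matrix.diagonal_kronecker_diagonal]
    congr 1
    ext x
    by_cases hx : χ x.2 <;> simp [κ, f, hx]
  refine ⟨f ∘ κ ∘ π, fun a b hab => hf (hπ hab), ?_⟩
  rw [hd, hPd]
  rfl

/-- Unitaries which sort `c ⊗ p` and `d ⊗ p`, and whose quotient is an ampliation of the quotient of
the unitaries which sort `c` and `d`. -/
lemma exists_unitaries_sorting_kronecker (e : Fin k × Fin n ≃ Fin (k * n))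
    {c d w v : Matrix (Fin k) (Fin k) ℂ} (hw : w ∈ unitary (Matrix (Fin k) (Fin k) ℂ))
    (hv : v ∈ unitary (Matrix (Fin k) (Fin k) ℂ)) {l m : Fin k → ℝ} (hl : Antitone l)
    (hl0 : ∀ i, 0 ≤ l i) (hm : Antitone m) (hm0 : ∀ i, 0 ≤ m i)
    (hwc : w * c * star w = Matrix.diagonal fun i => (l i : ℂ))
    (hvd : v * d * star v = Matrix.diagonal fun i => (m i : ℂ)) :
    ∃ U V : unitary (Matrix (Fin k × Fin n) (Fin k × Fin n) ℂ),
      IsSortedDiagonal e (U * (c ⊗ₖ coordProj χ) *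
        star (U : Matrix (Fin k × Fin n) (Fin k × Fin n) ℂ)) ∧
      IsSortedDiagonal e (V * (d ⊗ₖ coordProj χ) *
        star (V : Matrix (Fin k × Fin n) (Fin k × Fin n) ℂ)) ∧
      star (V : Matrix (Fin k × Fin n) (Fin k × Fin n) ℂ) * U =
        ampliation (coordProj χ) (star v * w) := by
  obtain ⟨P, hP, hPs⟩ := exists_unitary_sorting_kronecker χ e
  refine ⟨⟨_, mul_mem hP (ampliation_mem_unitary χ hw)⟩,
    ⟨_, mul_mem hP (ampliation_mem_unitary χ hv)⟩, ?_, ?_, ?_⟩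
  · convert hPs l hl hl0 using 1
    rw [← hwc, ← ampliation_conj_kronecker, star_mul]
    simp only [mul_assoc]
  · convert hPs m hm hm0 using 1
    rw [← hvd, ← ampliation_conj_kronecker, star_mul]
    simp only [mul_assoc]
  · simp only
    rw [star_mul, ← ampliation_mul_ampliation, ← star_ampliation, mul_assoc, ← mul_assoc (star P),
      Unitary.star_mul_self_of_mem hP, one_mul]

end CoordProj

lemma posSemidef_of_kronecker_one {c : Matrix (Fin k) (Fin k) ℂ} (hn : 1 ≤ n)
    (h : (c ⊗ₖ (1 : Matrix (Fin n) (Fin n) ℂ)).PosSemidef) : c.PosSemidef := by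
  have h1 := h.submatrix fun i : Fin k => (i, (⟨0, hn⟩ : Fin n))
  convert h1 using 1
  ext i j
  simp

end Boundary

/-! ### Unitary orbits in a Razak block -/

section UnitaryOrbits

open scoped Kronecker Matrix.Norms.L2Operator unitInterval ComplexOrder

variable {k n : ℕ}

/-- A continuous field of unitaries with the boundary values of an element of `1 + A` gives a
unitary in the unitisation. -/
lemma unitaryDist_le_of_continuous {a b : RazakBlock k n}
    {u : I → Matrix (Fin k × Fin n) (Fin k × Fin n) ℂ} (hu : Continuous u)
    (huu : ∀ x, u x ∈ unitary (Matrix (Fin k × Fin n) (Fin k × Fin n) ℂ))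
    {w : Matrix (Fin k) (Fin k) ℂ} (hu0 : u 0 = ampliation (cornerOne n) w)
    (hu1 : u 1 = ampliation 1 w) {C : ℝ} (hC : 0 ≤ C)
    (h : ∀ x, ‖u x * razakEval k n x a * star (u x) - razakEval k n x b‖ ≤ C) :
    unitaryDist a b ≤ C := by
  let f : RazakBlock k n := ⟨⟨fun x => u x - 1, by fun_prop⟩, w - 1, by
    simp [hu0, ampliation], by simp [hu1, ampliation]⟩
  have hf : ∀ x, razakEval k n x f = u x - 1 := fun x => rfl
  have h1 : star f + f + star f * f = 0 := by
    refine razakEval_ext fun x => ?_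
    have hx := Unitary.star_mul_self_of_mem (huu x)
    simp only [map_add, map_mul, map_star, map_zero, hf, star_sub, star_one, sub_mul, mul_sub,
      one_mul, mul_one, hx]
    abel
  have h2 : star f + f + f * star f = 0 := by
    refine razakEval_ext fun x => ?_
    have hx := Unitary.mul_star_self_of_mem (huu x)
    simp only [map_add, map_mul, map_star, map_zero, hf, star_sub, star_one, sub_mul, mul_sub,
      one_mul, mul_one, hx]
    abel
  set v : Unitization ℂ (RazakBlock k n) := 1 + (f : Unitization ℂ (RazakBlock k n))
  have hsv : star v = 1 + ((star f : RazakBlock k n) : Unitization ℂ (RazakBlock k n)) := by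
    simp only [v, star_add, star_one, Unitization.inr_star]
  have hv : v ∈ unitary (Unitization ℂ (RazakBlock k n)) := by
    have e1 : star v * v = 1 + ((star f + f + star f * f : RazakBlock k n) :
        Unitization ℂ (RazakBlock k n)) := by
      rw [hsv, Unitization.inr_add, Unitization.inr_add, Unitization.inr_mul]
      simp only [v]
      noncomm_ring
    have e2 : v * star v = 1 + ((star f + f + f * star f : RazakBlock k n) :
        Unitization ℂ (RazakBlock k n)) := by
      rw [hsv, Unitization.inr_add, Unitization.inr_add, Unitization.inr_mul]
      simp only [v]
      noncomm_ring
    rw [h1, Unitization.inr_zero, add_zero] at e1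
    rw [h2, Unitization.inr_zero, add_zero] at e2
    exact Unitary.mem_iff.2 ⟨e1, e2⟩
  refine (ciInf_le ⟨0, by rintro _ ⟨u, rfl⟩; exact norm_nonneg _⟩
    (⟨v, hv⟩ : unitary (Unitization ℂ (RazakBlock k n)))).trans ?_
  have hd : v * a * star v - b = ((a + f * a + a * star f + f * a * star f - b : RazakBlock k n) :
      Unitization ℂ (RazakBlock k n)) := by
    rw [hsv]
    simp only [Unitization.inr_add, Unitization.inr_sub, Unitization.inr_mul, v]
    noncomm_ring
  change ‖v * a * star v - b‖ ≤ C
  rw [hd, Unitization.norm_inr]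
  refine RazakBlock.norm_le_of_forall hC fun x => ?_
  have hx : razakEval k n x (a + f * a + a * star f + f * a * star f - b) =
      u x * razakEval k n x a * star (u x) - razakEval k n x b := by
    simp only [map_add, map_sub, map_mul, map_star, hf, star_sub, star_one]
    noncomm_ring
  rw [hx]
  exact h x

/-- The Cuntz distance dominates the distance between unitary orbits. The eigenvalues of `a` and
`b` are `r`-close in every fibre, and sorted diagonalisations can be chosen continuously up to
`ε`, with prescribed boundary values. -/
lemma unitaryDist_le_of_cuntzSubequiv (hn : 1 ≤ n) {a b : RazakBlock k n} (ha : 0 ≤ a)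
    (hb : 0 ≤ b) {r : ℝ} (hr : 0 < r)
    (h : ∀ t : ℝ, 0 < t → CuntzSubequiv (cutDown (t + r) a) (cutDown t b) ∧
      CuntzSubequiv (cutDown (t + r) b) (cutDown t a)) : unitaryDist a b ≤ r := by
  refine le_of_forall_pos_le_add fun ε hε => ?_
  set e : Fin k × Fin n ≃ Fin (k * n) := finProdFinEquiv
  obtain ⟨c, hc0, hc1⟩ := a.2
  obtain ⟨d, hd0, hd1⟩ := b.2
  have hc : c.PosSemidef := posSemidef_of_kronecker_one hn (hc1 ▸ posSemidef_razakEval ha 1)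
  have hd : d.PosSemidef := posSemidef_of_kronecker_one hn (hd1 ▸ posSemidef_razakEval hb 1)
  obtain ⟨w, hw, l, hl, hl0, hwc⟩ := exists_unitary_conj_eq_diagonal_of_posSemidef hc
  obtain ⟨v, hv, m, hm, hm0, hvd⟩ := exists_unitary_conj_eq_diagonal_of_posSemidef hd
  have hone : coordProj (fun _ : Fin n => True) = 1 := by simp [coordProj]
  obtain ⟨U₀, V₀, hU₀, hV₀, hUV₀⟩ := exists_unitaries_sorting_kronecker
    (fun j : Fin n => (j : ℕ) + 1 < n) e hw hv hl hl0 hm hm0 hwc hvd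
  obtain ⟨U₁, V₁, hU₁, hV₁, hUV₁⟩ := exists_unitaries_sorting_kronecker
    (fun _ : Fin n => True) e hw hv hl hl0 hm hm0 hwc hvd
  rw [hone] at hU₁ hV₁ hUV₁
  have hρ : ∀ x, ∀ U V : unitary (Matrix (Fin k × Fin n) (Fin k × Fin n) ℂ),
      IsSortedDiagonal e (U * razakEval k n x a *
        star (U : Matrix (Fin k × Fin n) (Fin k × Fin n) ℂ)) →
      IsSortedDiagonal e (V * razakEval k n x b *
        star (V : Matrix (Fin k × Fin n) (Fin k × Fin n) ℂ)) →
      ‖U * razakEval k n x a * star (U : Matrix (Fin k × Fin n) (Fin k × Fin n) ℂ) -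
        V * razakEval k n x b * star (V : Matrix (Fin k × Fin n) (Fin k × Fin n) ℂ)‖ < r + ε := by
    rintro x U V ⟨α, hα, hα'⟩ ⟨β, hβ, hβ'⟩
    have h1 := eigenvalue_le_add_of_cuntzSubequiv ha hb hr (fun t ht => (h t ht).1) e x hα hβ
      hα' hβ'
    have h2 := eigenvalue_le_add_of_cuntzSubequiv hb ha hr (fun t ht => (h t ht).2) e x hβ hα
      hβ' hα'
    rw [hα', hβ', Matrix.diagonal_sub, Matrix.l2_opNorm_diagonal]
    refine lt_of_le_of_lt ((pi_norm_le_iff_of_nonneg hr.le).2 fun i => ?_)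
      (lt_add_of_pos_right r hε)
    rw [← Complex.ofReal_sub, Complex.norm_real, Real.norm_eq_abs, abs_le]
    constructor <;> linarith [h1 i, h2 i]
  obtain ⟨U, V, hU, hV, hU0, hV0, hU1, hV1, hUV⟩ := exists_continuous_unitaries e
    (a := fun x => razakEval k n x a) (b := fun x => razakEval k n x b) (ρ := r + ε)
    (continuous_razakEval a) (continuous_razakEval b) (fun x => (posSemidef_razakEval ha x).1)
    (fun x => (posSemidef_razakEval hb x).1) hρ (U₀ := U₀) (V₀ := V₀) (U₁ := U₁) (V₁ := V₁)
    (by rwa [show razakEval k n 0 a = c ⊗ₖ cornerOne n from hc0])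
    (by rwa [show razakEval k n 0 b = d ⊗ₖ cornerOne n from hd0])
    (by rwa [show razakEval k n 1 a = c ⊗ₖ 1 from hc1])
    (by rwa [show razakEval k n 1 b = d ⊗ₖ 1 from hd1])
  refine unitaryDist_le_of_continuous
    (u := fun x => star (V x : Matrix (Fin k × Fin n) (Fin k × Fin n) ℂ) *
      (U x : Matrix (Fin k × Fin n) (Fin k × Fin n) ℂ))
    (w := star v * w)
    ((continuous_subtype_val.comp hV).star.mul (continuous_subtype_val.comp hU))
    (fun x => mul_mem (Unitary.star_mem (V x).2) (U x).2)
    (by simp only [hU0, hV0]; exact hUV₀) (by simp only [hU1, hV1]; exact hUV₁) (by positivity)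
    fun x => ?_
  have hV1 := Unitary.star_mul_self_of_mem (V x).2
  have key : star (V x : Matrix (Fin k × Fin n) (Fin k × Fin n) ℂ) * U x * razakEval k n x a *
        star (star (V x : Matrix (Fin k × Fin n) (Fin k × Fin n) ℂ) * U x) - razakEval k n x b =
      star (V x : Matrix (Fin k × Fin n) (Fin k × Fin n) ℂ) *
        (U x * razakEval k n x a * star (U x : Matrix (Fin k × Fin n) (Fin k × Fin n) ℂ) -
          V x * razakEval k n x b * star (V x : Matrix (Fin k × Fin n) (Fin k × Fin n) ℂ)) *
        V x := by
    rw [mul_sub, sub_mul, star_mul, star_star]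
    congr 1
    · simp only [mul_assoc]
    · calc razakEval k n x b
          = (star (V x : Matrix (Fin k × Fin n) (Fin k × Fin n) ℂ) * V x) * razakEval k n x b *
            (star (V x : Matrix (Fin k × Fin n) (Fin k × Fin n) ℂ) * V x) := by
            rw [hV1, one_mul, mul_one]
        _ = _ := by simp only [mul_assoc]
  rw [key, CStarRing.norm_mul_mem_unitary _ (V x).2,
    CStarRing.norm_mem_unitary_mul _ (Unitary.star_mem (V x).2)]
  exact (hUV x).le

end UnitaryOrbits

theorem mainTheorem3 (k n : ℕ) (hk : 1 ≤ k) (hn : 1 ≤ n) (a b : RazakBlock k n)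
    (ha : 0 ≤ a) (hb : 0 ≤ b) : unitaryDist a b = cuntzDist a b := by
  refine le_antisymm (le_csInf ?_ fun r hr => unitaryDist_le_of_cuntzSubequiv hn ha hb hr.1 hr.2)
    (cuntzDist_le_unitaryDist ha hb)
  refine ⟨‖a - b‖ + 1, by positivity, fun t ht => ⟨?_, ?_⟩⟩
  · exact cuntzSubequiv_cutDown_of_norm_sub_lt ha hb (lt_add_one _) ht
  · exact cuntzSubequiv_cutDown_of_norm_sub_lt hb ha (by rw [norm_sub_rev]; exact lt_add_one _) ht
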